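/- Let $\mathbb F=\mathbb R$ or $\mathbb C$, let $G$ be a topological group, $X$ a compact metric space, $\zeta:P\to X$ a (locally trivial) principal $G$-bundle, and $B$ a not necessarily unital Banach algebra over $\mathbb F$ on which $G$ acts by $\mathbb F$-algebra automorphisms, the action $G\times B\to B$ being continuous. Let $B^+=\mathbb F\oplus B$ be the unitization of $B$, with $G$ acting trivially on $\mathbb F$, and let $A_\zeta=\Gamma(X,P\times_G B)$ and $A_{\zeta^+}=\Gamma(X,P\times_G B^+)$ be the Banach algebras of continuous sections. Let $GL(A_{\zeta^+})$ be the group of invertible elements of $A_{\zeta^+}$, let $GL(A_\zeta)=\ker[GL((A_\zeta)^+)\to GL(\mathbb F)]$, where $(A_\zeta)^+=\mathbb F\oplus A_\zeta$, and let $GL_o$ denote the path component of the identity. The inclusion $A_\zeta\to A_{\zeta^+}$ induces $\iota:GL(A_\zeta)\to GL(A_{\zeta^+})$, the projection $B^+\to\mathbb F$ induces $p_*:GL(A_{\zeta^+})\to C(X,\mathbb F\setminus\{0\})$, and $\sigma(f)=f\cdot 1$ defines a homomorphism $\sigma:C(X,\mathbb F\setminus\{0\})\to GL(A_{\zeta^+})$.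 (1) Let $\mathbb F=\mathbb C$. There are isomorphisms $\theta_j:\pi_j(C(X,\mathbb C\setminus\{0\}))\cong\check H^{1-j}(X;\mathbb Z)$ for $j=0,1$ (unreduced Čech cohomology), natural with respect to continuous maps of compact metric spaces, such that for all $G,X,\zeta,B$ as above and $j=0,1$ $$0\to\pi_j(GL(A_\zeta))\xrightarrow{\ \iota_*\ }\pi_j(GL(A_{\zeta^+}))\xrightarrow{\ \theta_j\circ\pi_j(p_*)\ }\check H^{1-j}(X;\mathbb Z)\to 0$$ is a short exact sequence of groups, split by the homomorphism $\pi_j(\sigma)\circ\theta_j^{-1}$. The sequence and its splitting are natural with respect to maps of principal $G$-bundles (pullbacks) and continuous $G$-equivariant algebra homomorphisms $B\to B'$. (2) If $j\ge 2$, or if $\mathbb F=\mathbb R$ and $j\ge 1$, then $\iota$ induces an isomorphism $$\pi_j(GL_o(A_\zeta))\xrightarrow{\ \cong\ }\pi_j(GL_o(A_{\zeta^+})),$$ natural in the same sense. -/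

import Mathlib

open Topology

noncomputable section

namespace SectionGL

/-! ### Homotopy groups of topological groups -/

section Homotopy

variable {H K : Type*} [Group H] [TopologicalSpace H] [IsTopologicalGroup H]
  [Group K] [TopologicalSpace K] [IsTopologicalGroup K]

theorem joined_mul {a b c d : H} (h₁ : Joined a b) (h₂ : Joined c d) : Joined (a * c) (b * d) :=
  ⟨h₁.somePath.mul h₂.somePath⟩

theorem joined_map {S T : Type*} [TopologicalSpace S] [TopologicalSpace T] {a b : S} {f : S → T}
    (hf : Continuous f) (h : Joined a b) :
    Joined (f a) (f b) :=
  ⟨h.somePath.map hf⟩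

/-- The group structure on the set `π₀ H` of path components of a topological group. -/
instance : Group (ZerothHomotopy H) where
  mul := Quotient.map₂ (· * ·) fun _ _ h₁ _ _ h₂ => joined_mul h₁ h₂
  one := ZerothHomotopy.mk 1
  inv := Quotient.map (·⁻¹) fun _ _ h => joined_map continuous_inv h
  mul_assoc := by
    rintro ⟨a⟩ ⟨b⟩ ⟨c⟩
    exact congrArg ZerothHomotopy.mk (mul_assoc a b c)
  one_mul := by
    rintro ⟨a⟩
    exact congrArg ZerothHomotopy.mk (one_mul a)
  mul_one := by
    rintro ⟨a⟩
    exact congrArg ZerothHomotopy.mk (mul_one a)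
  inv_mul_cancel := by
    rintro ⟨a⟩
    exact congrArg ZerothHomotopy.mk (inv_mul_cancel a)

/-- The homomorphism induced on `π₀`. -/
def pi0Hom (f : H →ₜ* K) : ZerothHomotopy H →* ZerothHomotopy K where
  toFun := Quotient.map f fun _ _ h => joined_map f.continuous_toFun h
  map_one' := congrArg ZerothHomotopy.mk (map_one f)
  map_mul' := by
    rintro ⟨a⟩ ⟨b⟩
    exact congrArg ZerothHomotopy.mk (map_mul f a b)

/-- The map on `n`-dimensional loops based at `1`. -/
def genLoopMap {N : Type*} (f : H →ₜ* K) (p : GenLoop N H 1) : GenLoop N K 1 :=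
  ⟨(f : C(H, K)).comp p.1, fun y hy => by
    have h : p.1 y = 1 := p.2 y hy
    simp [h]⟩

/-- The homomorphism induced on `π_{k+1}`, base points being the unit elements. -/
def piHom (k : ℕ) (f : H →ₜ* K) : π_ (k + 1) H 1 →* π_ (k + 1) K 1 where
  toFun := Quotient.map (genLoopMap f) fun _ _ h => h.map fun F =>
    F.compContinuousMap (f : C(H, K))
  map_one' := by
    refine congrArg (Quotient.mk _) ?_
    ext y
    exact map_one f
  map_mul' := by
    rintro ⟨a⟩ ⟨b⟩
    have h1 := HomotopyGroup.mul_spec (i := (0 : Fin (k + 1))) (p := a) (q := b)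
    have h2 := HomotopyGroup.mul_spec (i := (0 : Fin (k + 1)))
      (p := genLoopMap f a) (q := genLoopMap f b)
    refine (congrArg _ h1).trans (Eq.trans ?_ h2.symm)
    refine congrArg (Quotient.mk _) ?_
    ext y
    change f (GenLoop.transAt 0 b a y) = GenLoop.transAt 0 (genLoopMap f b) (genLoopMap f a) y
    simp only [GenLoop.transAt, GenLoop.coe_copy]
    split_ifs <;> rfl

variable (H) in
/-- The path component of the identity. -/
def idComponent : Subgroup H where
  carrier := pathComponent 1
  one_mem' := mem_pathComponent_self 1
  mul_mem' := fun {a b} ha hb => by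
    have := joined_mul (a := (1 : H)) (c := 1) ha hb
    rwa [mul_one] at this
  inv_mem' := fun {a} ha => by
    have := joined_map (a := (1 : H)) continuous_inv ha
    rwa [inv_one] at this

/-- The restriction of a continuous homomorphism to identity components. -/
def idComponentMap (f : H →ₜ* K) : idComponent H →ₜ* idComponent K where
  toFun x := ⟨f x, by
    have := joined_map (a := (1 : H)) f.continuous_toFun x.2
    have h1 : f.toFun 1 = 1 := map_one f
    rwa [h1] at this⟩
  map_one' := Subtype.ext (map_one f)
  map_mul' x y := Subtype.ext (map_mul f x.1 y.1)
  continuous_toFun := by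
    exact (f.continuous_toFun.comp continuous_subtype_val).subtype_mk _

end Homotopy

/-- `1 → A → B → C → 1` is exact and `s` is a homomorphism splitting `q`. -/
structure IsSplitShortExact {A B C : Type*} [Group A] [Group B] [Group C]
    (i : A →* B) (q : B →* C) (s : C →* B) : Prop where
  injective : Function.Injective i
  exact : i.range = q.ker
  surjective : Function.Surjective q
  splits : q.comp s = MonoidHom.id C

/-! ### Čech cohomology with constant coefficients -/

section Cech

/-- An open cover of `X` indexed by the points of `X`, the point `x` lying in the `x`-th set.
Every open cover is refined by such a cover, and between two such covers there is a canonical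
refinement map, so these covers compute the Čech direct limit over all open covers. -/
structure PtCover (X : Type*) [TopologicalSpace X] where
  set : X → Set X
  isOpen : ∀ x, IsOpen (set x)
  mem : ∀ x, x ∈ set x

variable {X Y Z : Type*} [TopologicalSpace X] [TopologicalSpace Y] [TopologicalSpace Z]

/-- `U ≤ V` means that `V` is finer than `U`. -/
instance : Preorder (PtCover X) where
  le U V := ∀ x, V.set x ⊆ U.set x
  le_refl _ _ := subset_rfl
  le_trans _ _ _ h₁ h₂ x := (h₂ x).trans (h₁ x)

/-- Ordered `p`-simplices of the nerve of `U`. -/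
def Simplex (U : PtCover X) (p : ℕ) : Type _ :=
  {σ : Fin (p + 1) → X // (⋂ i, U.set (σ i)).Nonempty}

def Simplex.face {U : PtCover X} {p : ℕ} (σ : Simplex U (p + 1)) (i : Fin (p + 2)) :
    Simplex U p :=
  ⟨fun j => σ.1 (i.succAbove j), σ.2.mono fun _ hx =>
    Set.mem_iInter.2 fun j => Set.mem_iInter.1 hx (i.succAbove j)⟩

/-- `p`-cochains of the nerve of `U` with coefficients in `M`. -/
abbrev Cochain (U : PtCover X) (p : ℕ) (M : Type*) : Type _ := Simplex U p → M

variable {M : Type*} [AddCommGroup M]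

def coboundary (U : PtCover X) (p : ℕ) (M : Type*) [AddCommGroup M] :
    Cochain U p M →+ Cochain U (p + 1) M where
  toFun c σ := ∑ i : Fin (p + 2), (-1 : ℤ) ^ (i : ℕ) • c (σ.face i)
  map_zero' := by ext; simp
  map_add' a b := by ext; simp [Finset.sum_add_distrib]

/-- The group of `p`-coboundaries (zero for `p = 0`). -/
def boundaries (U : PtCover X) : (p : ℕ) → (M : Type*) → [AddCommGroup M] →
    AddSubgroup (Cochain U p M)
  | 0, _, _ => ⊥
  | p + 1, M, _ => (coboundary U p M).range

abbrev cocycles (U : PtCover X) (p : ℕ) (M : Type*) [AddCommGroup M] :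
    AddSubgroup (Cochain U p M) :=
  (coboundary U p M).ker

/-- The `p`-th cohomology of the nerve of `U`. -/
abbrev NerveCohomology (U : PtCover X) (p : ℕ) (M : Type*) [AddCommGroup M] : Type _ :=
  cocycles U p M ⧸ (boundaries U p M).addSubgroupOf (cocycles U p M)

/-- `f` maps the cover `V` of `Y` into the cover `U` of `X`. -/
def Subordinate (f : Y → X) (V : PtCover Y) (U : PtCover X) : Prop :=
  ∀ y, V.set y ⊆ f ⁻¹' U.set (f y)

def Simplex.map {V : PtCover Y} {U : PtCover X} (f : Y → X) (h : Subordinate f V U) {p : ℕ}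
    (σ : Simplex V p) : Simplex U p :=
  ⟨fun j => f (σ.1 j), by
    obtain ⟨y, hy⟩ := σ.2
    exact ⟨f y, Set.mem_iInter.2 fun j => h _ (Set.mem_iInter.1 hy j)⟩⟩

def cochainMap {V : PtCover Y} {U : PtCover X} (f : Y → X) (h : Subordinate f V U) (p : ℕ)
    (M : Type*) [AddCommGroup M] : Cochain U p M →+ Cochain V p M where
  toFun c σ := c (σ.map f h)
  map_zero' := rfl
  map_add' _ _ := rfl

theorem cochainMap_coboundary {V : PtCover Y} {U : PtCover X} (f : Y → X)
    (h : Subordinate f V U) (p : ℕ) (c : Cochain U p M) :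
    coboundary V p M (cochainMap f h p M c) = cochainMap f h (p + 1) M (coboundary U p M c) :=
  rfl

theorem cochainMap_boundaries {V : PtCover Y} {U : PtCover X} (f : Y → X)
    (h : Subordinate f V U) (p : ℕ) (c : Cochain U p M) (hc : c ∈ boundaries U p M) :
    cochainMap f h p M c ∈ boundaries V p M := by
  cases p with
  | zero =>
    have h0 : c = 0 := hc
    subst h0
    exact (boundaries V 0 M).zero_mem
  | succ p =>
    obtain ⟨b, rfl⟩ := hc
    exact ⟨cochainMap f h p M b, rfl⟩

def cocycleMap {V : PtCover Y} {U : PtCover X} (f : Y → X) (h : Subordinate f V U) (p : ℕ)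
    (M : Type*) [AddCommGroup M] : cocycles U p M →+ cocycles V p M :=
  ((cochainMap f h p M).comp (cocycles U p M).subtype).codRestrict _ fun c => by
    have hc : coboundary U p M c.1 = 0 := c.2
    change coboundary V p M (cochainMap f h p M c.1) = 0
    rw [cochainMap_coboundary, hc, map_zero]

/-- The map on nerve cohomology induced by `f`; for `f = id` this is the refinement map. -/
def nerveMap {V : PtCover Y} {U : PtCover X} (f : Y → X) (h : Subordinate f V U) (p : ℕ)
    (M : Type*) [AddCommGroup M] : NerveCohomology U p M →+ NerveCohomology V p M :=
  QuotientAddGroup.map _ _ (cocycleMap f h p M) fun c hc =>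
    cochainMap_boundaries f h p c.1 hc

open Classical in
/-- Čech cohomology `Ȟ^p(X; M)`: the direct limit over open covers, ordered by refinement, of the
cohomology of the nerves. -/
def Cech (X : Type*) [TopologicalSpace X] (p : ℕ) (M : Type*) [AddCommGroup M] : Type _ :=
  AddCommGroup.DirectLimit (fun U : PtCover X => NerveCohomology U p M)
    fun _ _ h => nerveMap id h p M

open Classical in
instance (p : ℕ) : AddCommGroup (Cech X p M) :=
  inferInstanceAs (AddCommGroup (AddCommGroup.DirectLimit
    (fun U : PtCover X => NerveCohomology U p M) fun _ _ h => nerveMap id h p M))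

/-- The inverse image of a cover. -/
def PtCover.pullback (f : C(Y, X)) (U : PtCover X) : PtCover Y where
  set y := f ⁻¹' U.set (f y)
  isOpen y := (U.isOpen (f y)).preimage f.continuous
  mem y := U.mem (f y)

open Classical in
/-- The homomorphism `f^* : Ȟ^p(X; M) → Ȟ^p(Y; M)` induced by `f : Y → X`. -/
def cechMap (f : C(Y, X)) (p : ℕ) (M : Type*) [AddCommGroup M] : Cech X p M →+ Cech Y p M :=
  AddCommGroup.DirectLimit.lift _ _ _
    (fun U => (AddCommGroup.DirectLimit.of
      (fun U : PtCover Y => NerveCohomology U p M) (fun _ _ h => nerveMap id h p M)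
        (U.pullback f)).comp (nerveMap f (fun _ => subset_rfl) p M))
    fun U V hUV x => by
      have hle : U.pullback f ≤ V.pullback f := fun y => Set.preimage_mono (hUV (f y))
      obtain ⟨c, rfl⟩ := QuotientAddGroup.mk_surjective x
      exact AddCommGroup.DirectLimit.of_f (G := fun U : PtCover Y => NerveCohomology U p M)
        (f := fun _ _ h => nerveMap id h p M) hle
        (nerveMap f (fun _ => subset_rfl) p M (QuotientAddGroup.mk c))

end Cech

/-! ### Principal bundles and associated bundles -/

/-- A principal `G`-bundle over `X` with total space `P`: locally over `X` it is equivariantly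
isomorphic to `U × G`. The action of `G` on `P` is written on the left; the customary right action
is `p · g = g⁻¹ • p`. -/
structure PrincipalBundle (G P X : Type*) [Group G] [TopologicalSpace G] [TopologicalSpace P]
    [TopologicalSpace X] [MulAction G P] where
  proj : P → X
  continuous_proj : Continuous proj
  proj_smul : ∀ (g : G) (p : P), proj (g • p) = proj p
  exists_trivialization : ∀ x : X, ∃ e : Bundle.Trivialization G proj, x ∈ e.baseSet ∧
    ∀ (g : G) (p : P), proj p ∈ e.baseSet → (e (g • p)).2 = g * (e p).2

section Bundle

variable {G P X : Type*} [Group G] [TopologicalSpace G] [TopologicalSpace P] [TopologicalSpace X]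
  [MulAction G P]

namespace PrincipalBundle

variable (ζ : PrincipalBundle G P X)

theorem exists_localSection (x : X) : ∃ (U : Set X) (s : X → P), IsOpen U ∧ x ∈ U ∧
    ContinuousOn s U ∧ ∀ y ∈ U, ζ.proj (s y) = y := by
  obtain ⟨e, hx, -⟩ := ζ.exists_trivialization x
  refine ⟨e.baseSet, fun y => e.toOpenPartialHomeomorph.symm (y, 1), e.open_baseSet, hx, ?_, ?_⟩
  · refine e.toOpenPartialHomeomorph.continuousOn_symm.comp (by fun_prop) fun y hy => ?_
    rw [e.target_eq]
    exact ⟨hy, trivial⟩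
  · intro y hy
    exact e.proj_symm_apply' hy

theorem proj_surjective : Function.Surjective ζ.proj := fun x => by
  obtain ⟨U, s, -, hx, -, h⟩ := ζ.exists_localSection x
  exact ⟨s x, h x hx⟩

/-- A point of `P` over `x`. -/
def point (x : X) : P := (ζ.proj_surjective x).choose

theorem proj_point (x : X) : ζ.proj (ζ.point x) = x := (ζ.proj_surjective x).choose_spec

theorem exists_smul_eq {p p' : P} (h : ζ.proj p = ζ.proj p') : ∃ g : G, g • p' = p := by
  obtain ⟨e, hx, he⟩ := ζ.exists_trivialization (ζ.proj p')
  refine ⟨(e p).2 * (e p').2⁻¹, ?_⟩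
  have hs : (((e p).2 * (e p').2⁻¹) • p') ∈ e.source := by
    rw [e.mem_source, ζ.proj_smul]; exact hx
  have hp : p ∈ e.source := by rw [e.mem_source, h]; exact hx
  refine e.injOn hs hp (Prod.ext ?_ ?_)
  · change (e _).1 = (e _).1
    rw [e.coe_fst hs, e.coe_fst hp, ζ.proj_smul, h]
  · change (e _).2 = (e _).2
    rw [he _ _ hx]; group

theorem smul_free (ζ : PrincipalBundle G P X) {g : G} {p : P} (h : g • p = p) : g = 1 := by
  obtain ⟨e, hx, he⟩ := ζ.exists_trivialization (ζ.proj p)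
  have := he g p hx
  rw [h] at this
  simpa using this

/-- The element of `G` carrying `p'` to `p`, for two points of one fibre. -/
def translation (q : {q : P × P // ζ.proj q.1 = ζ.proj q.2}) : G :=
  (ζ.exists_smul_eq q.2).choose

theorem translation_smul (q : {q : P × P // ζ.proj q.1 = ζ.proj q.2}) :
    ζ.translation q • q.1.2 = q.1.1 := (ζ.exists_smul_eq q.2).choose_spec

theorem continuous_translation [IsTopologicalGroup G] : Continuous ζ.translation := by
  rw [continuous_iff_continuousAt]
  intro q₀
  obtain ⟨e, hx, he⟩ := ζ.exists_trivialization (ζ.proj q₀.1.2)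
  have hs : ∀ p, p ∈ e.source ↔ ζ.proj p ∈ e.baseSet := fun p => e.mem_source
  have key : ∀ᶠ q in 𝓝 q₀, (e q.1.1).2 * (e q.1.2).2⁻¹ = ζ.translation q := by
    have hU : IsOpen {q : {q : P × P // ζ.proj q.1 = ζ.proj q.2} | ζ.proj q.1.2 ∈ e.baseSet} :=
      e.open_baseSet.preimage
        (ζ.continuous_proj.comp (continuous_snd.comp continuous_subtype_val))
    filter_upwards [hU.mem_nhds hx] with q hq
    have h1 := he (ζ.translation q) q.1.2 hq
    rw [ζ.translation_smul] at h1
    rw [h1]; group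
  refine ContinuousAt.congr ?_ key
  have c1 : ContinuousAt (fun q : {q : P × P // ζ.proj q.1 = ζ.proj q.2} => e q.1.1) q₀ :=
    ContinuousAt.comp (f := fun q : {q : P × P // ζ.proj q.1 = ζ.proj q.2} => q.1.1)
      (e.continuousAt ((hs _).2 (by rw [q₀.2]; exact hx)))
      (continuous_fst.comp continuous_subtype_val).continuousAt
  have c2 : ContinuousAt (fun q : {q : P × P // ζ.proj q.1 = ζ.proj q.2} => e q.1.2) q₀ :=
    ContinuousAt.comp (f := fun q : {q : P × P // ζ.proj q.1 = ζ.proj q.2} => q.1.2)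
      (e.continuousAt ((hs _).2 hx))
      (continuous_snd.comp continuous_subtype_val).continuousAt
  exact c1.snd.mul c2.snd.inv

/-- The map on `X` induced by a map on `P` that is constant on the fibres. -/
def descend {Z : Type*} (k : P → Z) (x : X) : Z := k (ζ.point x)

theorem descend_proj {Z : Type*} {k : P → Z} (hk : ∀ (g : G) p, k (g • p) = k p) (p : P) :
    ζ.descend k (ζ.proj p) = k p := by
  obtain ⟨g, hg⟩ := ζ.exists_smul_eq (ζ.proj_point (ζ.proj p))
  rw [descend, ← hg, hk]

theorem continuous_descend {T Z : Type*} [TopologicalSpace T] [TopologicalSpace Z]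
    {k : T → P → Z} (hc : Continuous fun q : T × P => k q.1 q.2)
    (hk : ∀ t (g : G) p, k t (g • p) = k t p) :
    Continuous fun q : T × X => ζ.descend (k q.1) q.2 := by
  rw [continuous_iff_continuousAt]
  rintro ⟨t, x⟩
  obtain ⟨U, s, hU, hx, hs, h⟩ := ζ.exists_localSection x
  have hs' : ContinuousAt (fun q : T × X => s q.2) (t, x) :=
    ContinuousAt.comp (f := Prod.snd) (hs.continuousAt (hU.mem_nhds hx)) continuous_snd.continuousAt
  have h1 : ContinuousAt (fun q : T × X => k q.1 (s q.2)) (t, x) :=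
    ContinuousAt.comp (f := fun q : T × X => (q.1, s q.2)) (g := fun q : T × P => k q.1 q.2)
      hc.continuousAt (continuous_fst.continuousAt.prodMk hs')
  refine h1.congr ?_
  filter_upwards [(hU.preimage continuous_snd).mem_nhds (x := ((t, x) : T × X)) hx] with q hq
  conv_rhs => rw [← h q.2 hq]
  exact (ζ.descend_proj (hk q.1) _).symm

end PrincipalBundle

variable (ζ : PrincipalBundle G P X) (F : Type*) [TopologicalSpace F] [MulAction G F]

/-- The total space of the associated bundle `P ×_G F`: the quotient of `P × F` by the diagonal
action of `G`. -/
def Assoc (_ζ : PrincipalBundle G P X) (F : Type*) [TopologicalSpace F] [MulAction G F] : Type _ :=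
  MulAction.orbitRel.Quotient G (P × F)

instance : TopologicalSpace (Assoc ζ F) :=
  inferInstanceAs (TopologicalSpace (Quotient (MulAction.orbitRel G (P × F))))

variable {F}

namespace Assoc

def mk (p : P) (b : F) : Assoc ζ F := Quotient.mk (MulAction.orbitRel G (P × F)) (p, b)

theorem mk_smul (g : G) (p : P) (b : F) : mk ζ (g • p) (g • b) = mk ζ p b :=
  Quotient.sound ⟨g, rfl⟩

theorem continuous_mk : Continuous fun q : P × F => mk ζ q.1 q.2 := continuous_quotient_mk'

/-- The bundle projection `P ×_G F → X`. -/
def proj : Assoc ζ F → X :=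
  Quotient.lift (fun q : P × F => ζ.proj q.1) (by
    rintro _ b ⟨g, rfl⟩
    exact ζ.proj_smul g b.1)

@[simp]
theorem proj_mk (p : P) (b : F) : proj ζ (mk ζ p b) = ζ.proj p := rfl

theorem mk_injective (p : P) : Function.Injective (mk ζ p : F → Assoc ζ F) := by
  intro b b' h
  obtain ⟨g, hg⟩ := Quotient.exact h
  have h1 : g • p = p := congrArg Prod.fst hg
  have h2 : g • b' = b := congrArg Prod.snd hg
  rw [← h2, ζ.smul_free h1, one_smul]

theorem exists_mk_eq {p : P} {e : Assoc ζ F} (h : ζ.proj p = proj ζ e) : ∃ b, mk ζ p b = e := by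
  obtain ⟨⟨p', b⟩, rfl⟩ := Quotient.exists_rep e
  obtain ⟨g, hg⟩ := ζ.exists_smul_eq (p := p) (p' := p') h
  refine ⟨g • b, ?_⟩
  rw [← hg]
  exact mk_smul ζ g p' b

/-- The identification of the fibre over `ζ.proj p` with `F` given by `p`. -/
def coord (q : {q : P × Assoc ζ F // ζ.proj q.1 = proj ζ q.2}) : F :=
  (exists_mk_eq ζ q.2).choose

theorem mk_coord (q : {q : P × Assoc ζ F // ζ.proj q.1 = proj ζ q.2}) :
    mk ζ q.1.1 (coord ζ q) = q.1.2 := (exists_mk_eq ζ q.2).choose_spec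

theorem continuous_coord [IsTopologicalGroup G] [ContinuousSMul G P] [ContinuousSMul G F] :
    Continuous (coord ζ (F := F)) := by
  let S : Set (P × Assoc ζ F) := {q | ζ.proj q.1 = proj ζ q.2}
  let m : P × (P × F) → P × Assoc ζ F := Prod.map id (Quotient.mk _)
  have hm : IsOpenQuotientMap m :=
    IsOpenQuotientMap.id.prodMap (MulAction.isOpenQuotientMap_quotientMk (Γ := G) (T := P × F))
  have hq : IsQuotientMap (S.restrictPreimage m) :=
    (hm.isOpenMap.restrictPreimage S).isQuotientMap (hm.continuous.restrictPreimage)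
      (hm.surjective.restrictPreimage S)
  refine hq.continuous_iff.2 ?_
  have : coord ζ ∘ S.restrictPreimage m =
      fun q => ζ.translation ⟨(q.1.1, q.1.2.1), q.2⟩ • q.1.2.2 := by
    funext q
    apply mk_injective ζ q.1.1
    refine (mk_coord ζ (S.restrictPreimage m q)).trans ?_
    have h := ζ.translation_smul ⟨(q.1.1, q.1.2.1), q.2⟩
    refine ((mk_smul ζ (ζ.translation ⟨(q.1.1, q.1.2.1), q.2⟩) q.1.2.1 q.1.2.2).symm).trans ?_
    exact congrArg (fun p => mk ζ p _) h
  rw [this]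
  refine (ζ.continuous_translation.comp ?_).smul ?_ <;> fun_prop

end Assoc

variable (F)

/-- Continuous sections of `P ×_G F`, with the compact-open topology. (For compact `X` and a Banach
algebra `F` this is the topology of uniform convergence, that is, the Banach algebra topology.) -/
def Sec : Type _ := {s : C(X, Assoc ζ F) // ∀ x, Assoc.proj ζ (s x) = x}

instance : TopologicalSpace (Sec ζ F) := inferInstanceAs (TopologicalSpace (Subtype _))

variable {F}

namespace Sec

variable {ζ}

/-- The value of the section `s` over `ζ.proj p`, read in `F` through `p`. -/
def coords (s : Sec ζ F) (p : P) : F :=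
  Assoc.coord ζ ⟨(p, s.1 (ζ.proj p)), (s.2 _).symm⟩

theorem mk_coords (s : Sec ζ F) (p : P) : Assoc.mk ζ p (s.coords p) = s.1 (ζ.proj p) :=
  Assoc.mk_coord ζ ⟨(p, s.1 (ζ.proj p)), (s.2 _).symm⟩

theorem coords_smul (s : Sec ζ F) (g : G) (p : P) : s.coords (g • p) = g • s.coords p := by
  apply Assoc.mk_injective ζ (g • p)
  rw [mk_coords, Assoc.mk_smul, mk_coords, ζ.proj_smul]

theorem coords_injective : Function.Injective (coords : Sec ζ F → P → F) := by
  intro s t h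
  refine Subtype.ext (ContinuousMap.ext fun x => ?_)
  obtain ⟨p, rfl⟩ := ζ.proj_surjective x
  rw [← mk_coords, ← mk_coords, h]

theorem continuous_coords [IsTopologicalGroup G] [ContinuousSMul G P] [ContinuousSMul G F]
    [LocallyCompactSpace X] : Continuous fun q : Sec ζ F × P => q.1.coords q.2 := by
  refine (Assoc.continuous_coord ζ).comp (Continuous.subtype_mk (continuous_snd.prodMk ?_) _)
  exact (continuous_eval (F := C(X, Assoc ζ F))).comp
    ((continuous_subtype_val.comp continuous_fst).prodMk (ζ.continuous_proj.comp continuous_snd))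

theorem continuous_coords_apply [IsTopologicalGroup G] [ContinuousSMul G P] [ContinuousSMul G F]
    (s : Sec ζ F) : Continuous s.coords :=
  (Assoc.continuous_coord ζ).comp (Continuous.subtype_mk
    (continuous_id.prodMk (s.1.continuous.comp ζ.continuous_proj)) _)

/-- The section `x ↦ [p, h p]` (`p` any point over `x`) given by an equivariant map `h`. -/
def ofEquivariant (h : P → F) (hc : Continuous h) (hg : ∀ (g : G) p, h (g • p) = g • h p) :
    Sec ζ F :=
  ⟨⟨ζ.descend fun p => Assoc.mk ζ p (h p), by
    have := ζ.continuous_descend (T := Unit) (k := fun _ p => Assoc.mk ζ p (h p))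
      ((Assoc.continuous_mk ζ).comp (continuous_snd.prodMk (hc.comp continuous_snd)))
      (fun _ g p => by rw [hg, Assoc.mk_smul])
    exact this.comp (continuous_const (y := ()).prodMk continuous_id)⟩, fun x => by
    change Assoc.proj ζ (Assoc.mk ζ _ _) = x
    rw [Assoc.proj_mk, ζ.proj_point]⟩

@[simp]
theorem coords_ofEquivariant (h : P → F) (hc : Continuous h)
    (hg : ∀ (g : G) p, h (g • p) = g • h p) : (ofEquivariant (ζ := ζ) h hc hg).coords = h := by
  funext p
  apply Assoc.mk_injective ζ p
  rw [mk_coords]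
  exact ζ.descend_proj (k := fun p => Assoc.mk ζ p (h p))
    (fun g p => by rw [hg, Assoc.mk_smul]) p

theorem continuous_ofEquivariant {T : Type*} [TopologicalSpace T] {h : T → P → F}
    (hj : Continuous fun q : T × P => h q.1 q.2) (hc : ∀ t, Continuous (h t))
    (hg : ∀ t (g : G) p, h t (g • p) = g • h t p) :
    Continuous fun t => ofEquivariant (ζ := ζ) (h t) (hc t) (hg t) := by
  refine Continuous.subtype_mk (ContinuousMap.continuous_of_continuous_uncurry _ ?_) _
  exact ζ.continuous_descend (k := fun t p => Assoc.mk ζ p (h t p))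
    ((Assoc.continuous_mk ζ).comp (continuous_snd.prodMk hj))
    (fun t g p => by rw [hg, Assoc.mk_smul])

end Sec

/-- `G` acts on the algebra `F` by multiplicative maps. -/
class MulAct (G F : Type*) [Group G] [NonUnitalRing F] [DistribMulAction G F] : Prop where
  smul_mul' : ∀ (g : G) (a b : F), g • (a * b) = g • a * g • b

instance {G F : Type*} [Group G] [Ring F] [MulSemiringAction G F] : MulAct G F :=
  ⟨MulSemiringAction.smul_mul⟩

/-! ### The algebra of sections -/

namespace Sec

section Algebra

variable {ζ : PrincipalBundle G P X} [IsTopologicalGroup G] [ContinuousSMul G P]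
  {F : Type*} [NonUnitalRing F] [TopologicalSpace F] [IsTopologicalRing F]
  [DistribMulAction G F] [ContinuousSMul G F]

instance : Zero (Sec ζ F) := ⟨ofEquivariant (fun _ => 0) continuous_const fun _ _ => by simp⟩

instance : Add (Sec ζ F) := ⟨fun s t => ofEquivariant (fun p => s.coords p + t.coords p)
  (s.continuous_coords_apply.add t.continuous_coords_apply)
  fun _ _ => by simp [coords_smul]⟩

instance : Neg (Sec ζ F) := ⟨fun s => ofEquivariant (fun p => -s.coords p)
  s.continuous_coords_apply.neg fun _ _ => by simp [coords_smul]⟩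

instance : Sub (Sec ζ F) := ⟨fun s t => ofEquivariant (fun p => s.coords p - t.coords p)
  (s.continuous_coords_apply.sub t.continuous_coords_apply)
  fun _ _ => by simp [coords_smul, smul_sub]⟩

instance [MulAct G F] : Mul (Sec ζ F) := ⟨fun s t =>
  ofEquivariant (fun p => s.coords p * t.coords p)
    (s.continuous_coords_apply.mul t.continuous_coords_apply)
    fun _ _ => by simp [coords_smul, MulAct.smul_mul']⟩

instance {R : Type*} [SMul R F] [SMulCommClass G R F] [ContinuousConstSMul R F] :
    SMul R (Sec ζ F) := ⟨fun r s => ofEquivariant (fun p => r • s.coords p)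
  (s.continuous_coords_apply.const_smul r) fun _ _ => by simp [coords_smul, smul_comm]⟩

theorem coords_zero : coords (0 : Sec ζ F) = 0 := coords_ofEquivariant _ _ _

theorem coords_add (s t : Sec ζ F) : coords (s + t) = coords s + coords t :=
  coords_ofEquivariant _ _ _

theorem coords_neg (s : Sec ζ F) : coords (-s) = -coords s := coords_ofEquivariant _ _ _

theorem coords_sub (s t : Sec ζ F) : coords (s - t) = coords s - coords t :=
  coords_ofEquivariant _ _ _

theorem coords_mul [MulAct G F] (s t : Sec ζ F) : coords (s * t) = coords s * coords t :=
  coords_ofEquivariant _ _ _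

theorem coords_rsmul {R : Type*} [SMul R F] [SMulCommClass G R F] [ContinuousConstSMul R F]
    (r : R) (s : Sec ζ F) : coords (r • s) = r • coords s := coords_ofEquivariant _ _ _

/-- Addition and multiplication of sections are fibrewise. -/
instance [MulAct G F] : NonUnitalRing (Sec ζ F) :=
  coords_injective.nonUnitalRing coords coords_zero coords_add coords_mul coords_neg coords_sub
    (fun _ _ => coords_rsmul _ _) (fun _ _ => coords_rsmul _ _)

variable {𝕜 : Type*} [CommRing 𝕜] [Module 𝕜 F] [SMulCommClass G 𝕜 F] [ContinuousConstSMul 𝕜 F]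
  [MulAct G F]

instance : Module 𝕜 (Sec ζ F) :=
  coords_injective.module 𝕜 (⟨⟨coords, coords_zero⟩, coords_add⟩ : Sec ζ F →+ (P → F))
    fun r s => coords_rsmul r s

instance [IsScalarTower 𝕜 F F] : IsScalarTower 𝕜 (Sec ζ F) (Sec ζ F) :=
  ⟨fun r s t => coords_injective (by
    simp only [smul_eq_mul, coords_mul, coords_rsmul, smul_mul_assoc])⟩

instance [SMulCommClass 𝕜 F F] : SMulCommClass 𝕜 (Sec ζ F) (Sec ζ F) :=
  ⟨fun r s t => coords_injective (by
    simp only [smul_eq_mul, coords_mul, coords_rsmul, mul_smul_comm])⟩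

variable [LocallyCompactSpace X]

instance : ContinuousAdd (Sec ζ F) := ⟨by
  refine continuous_ofEquivariant (T := Sec ζ F × Sec ζ F)
    (h := fun q p => q.1.coords p + q.2.coords p) ?_ _ _
  exact (continuous_coords.comp ((continuous_fst.comp continuous_fst).prodMk continuous_snd)).add
    (continuous_coords.comp ((continuous_snd.comp continuous_fst).prodMk continuous_snd))⟩

instance : ContinuousNeg (Sec ζ F) := ⟨by
  refine continuous_ofEquivariant (T := Sec ζ F) (h := fun q p => -q.coords p) ?_ _ _
  exact continuous_coords.neg⟩

instance : ContinuousMul (Sec ζ F) := ⟨by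
  refine continuous_ofEquivariant (T := Sec ζ F × Sec ζ F)
    (h := fun q p => q.1.coords p * q.2.coords p) ?_ _ _
  exact (continuous_coords.comp ((continuous_fst.comp continuous_fst).prodMk continuous_snd)).mul
    (continuous_coords.comp ((continuous_snd.comp continuous_fst).prodMk continuous_snd))⟩

instance : IsTopologicalRing (Sec ζ F) where

instance [TopologicalSpace 𝕜] [ContinuousSMul 𝕜 F] : ContinuousSMul 𝕜 (Sec ζ F) := ⟨by
  refine continuous_ofEquivariant (T := 𝕜 × Sec ζ F)
    (h := fun q p => q.1 • q.2.coords p) ?_ _ _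
  exact (continuous_fst.comp continuous_fst).smul
    (continuous_coords.comp ((continuous_snd.comp continuous_fst).prodMk continuous_snd))⟩

end Algebra

section Unital

variable {ζ : PrincipalBundle G P X} [IsTopologicalGroup G] [ContinuousSMul G P]
  {F : Type*} [Ring F] [TopologicalSpace F] [IsTopologicalRing F]
  [MulSemiringAction G F] [ContinuousSMul G F]

instance : One (Sec ζ F) := ⟨ofEquivariant (fun _ => 1) continuous_const fun _ _ => by simp⟩

theorem coords_one : coords (1 : Sec ζ F) = 1 := coords_ofEquivariant _ _ _

instance : Ring (Sec ζ F) where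
  __ := (inferInstance : NonUnitalRing (Sec ζ F))
  one_mul s := coords_injective (by rw [coords_mul, coords_one, one_mul])
  mul_one s := coords_injective (by rw [coords_mul, coords_one, mul_one])

instance {𝕜 : Type*} [CommRing 𝕜] [Algebra 𝕜 F] [SMulCommClass G 𝕜 F]
    [ContinuousConstSMul 𝕜 F] : Algebra 𝕜 (Sec ζ F) :=
  Algebra.ofModule smul_mul_assoc mul_smul_comm

end Unital

end Sec

end Bundle

/-! ### Unitization and general linear groups -/

section Plus

/-- The unitization `A⁺ = 𝕜 ⊕ A`, with the product topology. -/
def Plus (𝕜 A : Type*) : Type _ := Unitization 𝕜 A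

namespace Plus

variable {𝕜 A : Type*} [CommRing 𝕜] [NonUnitalRing A]
  [Module 𝕜 A] [IsScalarTower 𝕜 A A] [SMulCommClass 𝕜 A A]

instance : Ring (Plus 𝕜 A) := inferInstanceAs (Ring (Unitization 𝕜 A))

instance : Algebra 𝕜 (Plus 𝕜 A) := inferInstanceAs (Algebra 𝕜 (Unitization 𝕜 A))

def mk {𝕜 A : Type*} (r : 𝕜) (a : A) : Plus 𝕜 A := Unitization.mk (r, a)

def fst {𝕜 A : Type*} (x : Plus 𝕜 A) : 𝕜 := Unitization.toProd x |>.1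

def snd {𝕜 A : Type*} (x : Plus 𝕜 A) : A := Unitization.toProd x |>.2

theorem ext {𝕜 A : Type*} {x y : Plus 𝕜 A} (h₁ : fst x = fst y) (h₂ : snd x = snd y) : x = y :=
  Unitization.toProd_injective (Prod.ext h₁ h₂)

section

variable (x y : Plus 𝕜 A) (r : 𝕜)

theorem fst_one : fst (1 : Plus 𝕜 A) = 1 := rfl
theorem fst_mul : fst (x * y) = fst x * fst y := rfl
theorem fst_add : fst (x + y) = fst x + fst y := rfl
theorem snd_mul : snd (x * y) = fst x • snd y + fst y • snd x + snd x * snd y := rfl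

end

instance {𝕜 A : Type*} [TopologicalSpace 𝕜] [TopologicalSpace A] :
    TopologicalSpace (Plus 𝕜 A) :=
  TopologicalSpace.induced (fun x => (fst x, snd x)) inferInstance

section Topology

variable [TopologicalSpace 𝕜] [TopologicalSpace A]

theorem continuous_pair {𝕜 A : Type*} [TopologicalSpace 𝕜] [TopologicalSpace A] :
    Continuous fun x : Plus 𝕜 A => (fst x, snd x) := continuous_induced_dom

theorem continuous_fst {𝕜 A : Type*} [TopologicalSpace 𝕜] [TopologicalSpace A] :
    Continuous (fst : Plus 𝕜 A → 𝕜) := _root_.continuous_fst.comp continuous_pair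

theorem continuous_snd {𝕜 A : Type*} [TopologicalSpace 𝕜] [TopologicalSpace A] :
    Continuous (snd : Plus 𝕜 A → A) := _root_.continuous_snd.comp continuous_pair

theorem continuous_rng {𝕜 A : Type*} [TopologicalSpace 𝕜] [TopologicalSpace A] {T : Type*}
    [TopologicalSpace T] {f : T → Plus 𝕜 A} (h₁ : Continuous fun t => fst (f t))
    (h₂ : Continuous fun t => snd (f t)) : Continuous f :=
  continuous_induced_rng.2 (h₁.prodMk h₂)

variable [IsTopologicalRing 𝕜] [IsTopologicalRing A] [ContinuousSMul 𝕜 A]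

instance : IsTopologicalRing (Plus 𝕜 A) where
  continuous_add := continuous_rng
    ((continuous_fst.comp _root_.continuous_fst).add (continuous_fst.comp _root_.continuous_snd))
    ((continuous_snd.comp _root_.continuous_fst).add (continuous_snd.comp _root_.continuous_snd))
  continuous_mul := by
    have f1 : Continuous fun q : Plus 𝕜 A × Plus 𝕜 A => fst q.1 :=
      continuous_fst.comp _root_.continuous_fst
    have f2 : Continuous fun q : Plus 𝕜 A × Plus 𝕜 A => fst q.2 :=
      continuous_fst.comp _root_.continuous_snd
    have s1 : Continuous fun q : Plus 𝕜 A × Plus 𝕜 A => snd q.1 :=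
      continuous_snd.comp _root_.continuous_fst
    have s2 : Continuous fun q : Plus 𝕜 A × Plus 𝕜 A => snd q.2 :=
      continuous_snd.comp _root_.continuous_snd
    exact continuous_rng (f1.mul f2) (((f1.smul s2).add (f2.smul s1)).add (s1.mul s2))
  continuous_neg := continuous_rng continuous_fst.neg continuous_snd.neg

instance : ContinuousSMul 𝕜 (Plus 𝕜 A) := ⟨continuous_rng
  (_root_.continuous_fst.mul (continuous_fst.comp _root_.continuous_snd))
  (_root_.continuous_fst.smul (continuous_snd.comp _root_.continuous_snd))⟩

end Topology

section Action

variable {G : Type*} [Group G] [DistribMulAction G A] [SMulCommClass G 𝕜 A] [MulAct G A]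

/-- The extension of a `G`-action to the unitization, fixing the scalars. -/
instance : MulSemiringAction G (Plus 𝕜 A) where
  smul g x := mk (fst x) (g • snd x)
  one_smul x := ext rfl (one_smul G (snd x))
  mul_smul g h x := ext rfl (mul_smul g h (snd x))
  smul_zero g := ext rfl (smul_zero g)
  smul_add g x y := ext rfl (smul_add g (snd x) (snd y))
  smul_one g := ext rfl (smul_zero g)
  smul_mul g x y := ext rfl (by
    change g • (fst x • snd y + fst y • snd x + snd x * snd y) =
      fst x • g • snd y + fst y • g • snd x + g • snd x * g • snd y
    rw [smul_add, smul_add, MulAct.smul_mul', smul_comm g, smul_comm g])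

theorem fst_smul (g : G) (x : Plus 𝕜 A) : fst (g • x) = fst x := rfl
theorem snd_smul (g : G) (x : Plus 𝕜 A) : snd (g • x) = g • snd x := rfl

instance : SMulCommClass G 𝕜 (Plus 𝕜 A) :=
  ⟨fun g r x => ext rfl (smul_comm g r (snd x))⟩

instance [TopologicalSpace 𝕜] [TopologicalSpace A] [TopologicalSpace G] [ContinuousSMul G A] :
    ContinuousSMul G (Plus 𝕜 A) := ⟨continuous_rng
  (show Continuous fun q : G × Plus 𝕜 A => fst q.2 from continuous_fst.comp _root_.continuous_snd)
  (_root_.continuous_fst.smul (continuous_snd.comp _root_.continuous_snd))⟩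

end Action

variable (𝕜 A) in
/-- The character `A⁺ → 𝕜`. -/
def fstHom : Plus 𝕜 A →ₐ[𝕜] 𝕜 := Unitization.fstHom 𝕜 A

variable (𝕜 A) in
/-- The inclusion `A → A⁺`. -/
def inrHom : A →ₙₐ[𝕜] Plus 𝕜 A := Unitization.inrNonUnitalAlgHom 𝕜 A

/-- The extension `r + a ↦ r · 1 + φ a` of `φ` to `A⁺`. -/
def lift {C : Type*} [Ring C] [Algebra 𝕜 C] (φ : A →ₙₐ[𝕜] C) : Plus 𝕜 A →ₐ[𝕜] C :=
  Unitization.lift φ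

theorem continuous_lift {C : Type*} [Ring C] [Algebra 𝕜 C] [TopologicalSpace 𝕜]
    [TopologicalSpace A] [TopologicalSpace C] [ContinuousAdd C] [ContinuousSMul 𝕜 C]
    (φ : A →ₙₐ[𝕜] C) (hφ : Continuous φ) : Continuous (lift φ) :=
  ((continuous_algebraMap 𝕜 C).comp continuous_fst).add (hφ.comp continuous_snd)

/-- The unital extension `A⁺ → A'⁺` of `φ : A → A'`. -/
def map {A' : Type*} [NonUnitalRing A'] [Module 𝕜 A'] [IsScalarTower 𝕜 A' A']
    [SMulCommClass 𝕜 A' A'] (φ : A →ₙₐ[𝕜] A') : Plus 𝕜 A →ₐ[𝕜] Plus 𝕜 A' :=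
  lift ((inrHom 𝕜 A').comp φ)

theorem fst_map {A' : Type*} [NonUnitalRing A'] [Module 𝕜 A'] [IsScalarTower 𝕜 A' A']
    [SMulCommClass 𝕜 A' A'] (φ : A →ₙₐ[𝕜] A') (x : Plus 𝕜 A) : fst (map φ x) = fst x :=
  add_zero (fst x)

theorem snd_map {A' : Type*} [NonUnitalRing A'] [Module 𝕜 A'] [IsScalarTower 𝕜 A' A']
    [SMulCommClass 𝕜 A' A'] (φ : A →ₙₐ[𝕜] A') (x : Plus 𝕜 A) : snd (map φ x) = φ (snd x) :=
  zero_add (φ (snd x))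

theorem continuous_map {A' : Type*} [NonUnitalRing A'] [Module 𝕜 A'] [IsScalarTower 𝕜 A' A']
    [SMulCommClass 𝕜 A' A'] [TopologicalSpace 𝕜] [TopologicalSpace A] [TopologicalSpace A']
    (φ : A →ₙₐ[𝕜] A') (hφ : Continuous φ) : Continuous (map φ) := by
  refine continuous_rng ?_ ?_
  · simp only [fst_map]; exact continuous_fst
  · simp only [snd_map]; exact hφ.comp continuous_snd

end Plus

variable (𝕜 : Type*) [CommRing 𝕜]

/-- `GL(A)` for a non-unital algebra `A`: the kernel of `GL(A⁺) → GL(A⁺/A) = GL(𝕜)`. -/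
abbrev GLnu (A : Type*) [NonUnitalRing A] [Module 𝕜 A] [IsScalarTower 𝕜 A A]
    [SMulCommClass 𝕜 A A] : Subgroup (Plus 𝕜 A)ˣ :=
  (Units.map (Plus.fstHom 𝕜 A : Plus 𝕜 A →* 𝕜)).ker

end Plus

/-! ### Maps of bundles and of section algebras -/

section Maps

variable {G P X P' X' : Type*} [Group G] [TopologicalSpace G] [IsTopologicalGroup G]
  [TopologicalSpace P] [TopologicalSpace X] [MulAction G P] [ContinuousSMul G P]
  [TopologicalSpace P'] [TopologicalSpace X'] [MulAction G P'] [ContinuousSMul G P']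

/-- A map of principal `G`-bundles `ζ' → ζ` covering `base : X' → X` (so that `ζ'` is the pullback
of `ζ` along `base`). -/
structure BundleMap (ζ' : PrincipalBundle G P' X') (ζ : PrincipalBundle G P X) where
  base : C(X', X)
  total : C(P', P)
  proj_total : ∀ p, ζ.proj (total p) = base (ζ'.proj p)
  total_smul : ∀ (g : G) p, total (g • p) = g • total p

def BundleMap.id (ζ : PrincipalBundle G P X) : BundleMap ζ ζ where
  base := ContinuousMap.id X
  total := ContinuousMap.id P
  proj_total _ := rfl
  total_smul _ _ := rfl

variable (𝕜 : Type*) [CommRing 𝕜] [TopologicalSpace 𝕜] [IsTopologicalRing 𝕜]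

/-- Continuous `G`-equivariant algebra homomorphisms. -/
structure EquivariantHom (G F F' : Type*) [Group G]
    [NonUnitalRing F] [TopologicalSpace F] [Module 𝕜 F] [DistribMulAction G F]
    [NonUnitalRing F'] [TopologicalSpace F'] [Module 𝕜 F'] [DistribMulAction G F'] where
  toHom : F →ₙₐ[𝕜] F'
  continuous : Continuous toHom
  map_smul : ∀ (g : G) b, toHom (g • b) = g • toHom b

section

variable {𝕜}
variable {ζ : PrincipalBundle G P X} {ζ' : PrincipalBundle G P' X'}
  {F F' : Type*} [NonUnitalRing F] [TopologicalSpace F] [IsTopologicalRing F] [Module 𝕜 F]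
  [DistribMulAction G F] [ContinuousSMul G F] [MulAct G F] [SMulCommClass G 𝕜 F]
  [ContinuousConstSMul 𝕜 F]
  [NonUnitalRing F'] [TopologicalSpace F'] [IsTopologicalRing F'] [Module 𝕜 F']
  [DistribMulAction G F'] [ContinuousSMul G F'] [MulAct G F'] [SMulCommClass G 𝕜 F']
  [ContinuousConstSMul 𝕜 F']

/-- The homomorphism `Γ(X, P ×_G F) → Γ(X', P' ×_G F')` induced by a bundle map `ζ' → ζ` and an
equivariant homomorphism `α : F → F'`. -/
def secMap (m : BundleMap ζ' ζ) (α : EquivariantHom 𝕜 G F F') : Sec ζ F →ₙₐ[𝕜] Sec ζ' F' where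
  toFun s := Sec.ofEquivariant (fun p => α.toHom (s.coords (m.total p)))
    (α.continuous.comp (s.continuous_coords_apply.comp m.total.continuous))
    fun g p => by rw [m.total_smul, Sec.coords_smul, α.map_smul]
  map_smul' r s := Sec.coords_injective (by
    rw [Sec.coords_ofEquivariant, Sec.coords_rsmul, Sec.coords_rsmul, Sec.coords_ofEquivariant]
    funext p
    exact map_smul α.toHom r _)
  map_zero' := Sec.coords_injective (by
    rw [Sec.coords_ofEquivariant, Sec.coords_zero, Sec.coords_zero]
    funext p
    exact map_zero α.toHom)
  map_add' s t := Sec.coords_injective (by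
    rw [Sec.coords_ofEquivariant, Sec.coords_add, Sec.coords_add, Sec.coords_ofEquivariant,
      Sec.coords_ofEquivariant]
    funext p
    exact map_add α.toHom _ _)
  map_mul' s t := Sec.coords_injective (by
    rw [Sec.coords_ofEquivariant, Sec.coords_mul, Sec.coords_mul, Sec.coords_ofEquivariant,
      Sec.coords_ofEquivariant]
    funext p
    exact map_mul α.toHom _ _)

theorem coords_secMap (m : BundleMap ζ' ζ) (α : EquivariantHom 𝕜 G F F') (s : Sec ζ F) (p : P') :
    (secMap m α s).coords p = α.toHom (s.coords (m.total p)) :=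
  congrFun (Sec.coords_ofEquivariant (fun p => α.toHom (s.coords (m.total p)))
    (α.continuous.comp (s.continuous_coords_apply.comp m.total.continuous))
    fun g p => by rw [m.total_smul, Sec.coords_smul, α.map_smul]) p

theorem continuous_secMap [LocallyCompactSpace X] (m : BundleMap ζ' ζ)
    (α : EquivariantHom 𝕜 G F F') : Continuous (secMap m α) := by
  refine Sec.continuous_ofEquivariant (T := Sec ζ F)
    (h := fun s p => α.toHom (s.coords (m.total p))) ?_
    (fun s => α.continuous.comp (s.continuous_coords_apply.comp m.total.continuous))
    fun s g p => by rw [m.total_smul, Sec.coords_smul, α.map_smul]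
  exact α.continuous.comp (Sec.continuous_coords.comp
    (continuous_fst.prodMk (m.total.continuous.comp continuous_snd)))

end

variable {𝕜}
variable [LocallyCompactSpace X] [LocallyCompactSpace X']
variable (ζ : PrincipalBundle G P X) (ζ' : PrincipalBundle G P' X')
  {B B' : Type*} [NonUnitalRing B] [TopologicalSpace B] [IsTopologicalRing B] [Module 𝕜 B]
  [IsScalarTower 𝕜 B B] [SMulCommClass 𝕜 B B] [ContinuousSMul 𝕜 B]
  [DistribMulAction G B] [ContinuousSMul G B] [MulAct G B] [SMulCommClass G 𝕜 B]
  [NonUnitalRing B'] [TopologicalSpace B'] [IsTopologicalRing B'] [Module 𝕜 B']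
  [IsScalarTower 𝕜 B' B'] [SMulCommClass 𝕜 B' B'] [ContinuousSMul 𝕜 B']
  [DistribMulAction G B'] [ContinuousSMul G B'] [MulAct G B'] [SMulCommClass G 𝕜 B']

variable (𝕜 B)

/-- The inclusion `B → B⁺`. -/
def inclPlus : EquivariantHom 𝕜 G B (Plus 𝕜 B) where
  toHom := Plus.inrHom 𝕜 B
  continuous := Plus.continuous_rng continuous_const continuous_id
  map_smul _ _ := rfl

/-- `GL(A_ζ)`, where `A_ζ = Γ(X, P ×_G B)` is regarded as a non-unital algebra. -/
abbrev GLsec : Subgroup (Plus 𝕜 (Sec ζ B))ˣ := GLnu 𝕜 (Sec ζ B)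

/-- `GL(A_{ζ⁺})`, the group of invertible elements of `A_{ζ⁺} = Γ(X, P ×_G B⁺)`. -/
abbrev GLsecPlus : Type _ := (Sec ζ (Plus 𝕜 B))ˣ

/-- The homomorphism `GL(A_ζ) → GL(A_{ζ⁺})`, induced by `A_ζ → A_{ζ⁺}`. -/
def glIncl : GLsec 𝕜 ζ B →ₜ* GLsecPlus 𝕜 ζ B where
  toMonoidHom := (Units.map (Plus.lift (secMap (BundleMap.id ζ) (inclPlus 𝕜 B)) :
    Plus 𝕜 (Sec ζ B) →* Sec ζ (Plus 𝕜 B))).comp (GLsec 𝕜 ζ B).subtype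
  continuous_toFun := (Continuous.units_map _ (Plus.continuous_lift _
    (continuous_secMap (BundleMap.id ζ) (inclPlus 𝕜 B)))).comp continuous_subtype_val

/-- The invertible scalar `p(u(x))`, `x = ζ.proj p`. -/
def unitPart (u : GLsecPlus 𝕜 ζ B) (p : P) : 𝕜ˣ where
  val := (u.val.coords p).fst
  inv := (u⁻¹.val.coords p).fst
  val_inv := by
    rw [← Plus.fst_mul, ← Pi.mul_apply, ← Sec.coords_mul, Units.mul_inv, Sec.coords_one]
    rfl
  inv_val := by
    rw [← Plus.fst_mul, ← Pi.mul_apply, ← Sec.coords_mul, Units.inv_mul, Sec.coords_one]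
    rfl

theorem unitPart_smul (u : GLsecPlus 𝕜 ζ B) (g : G) (p : P) :
    unitPart 𝕜 ζ B u (g • p) = unitPart 𝕜 ζ B u p := by
  apply Units.ext
  change (u.val.coords (g • p)).fst = (u.val.coords p).fst
  rw [Sec.coords_smul, Plus.fst_smul]

theorem continuous_unitPart :
    Continuous fun q : GLsecPlus 𝕜 ζ B × P => unitPart 𝕜 ζ B q.1 q.2 := by
  refine Units.continuous_iff.2 ⟨?_, ?_⟩
  · exact Plus.continuous_fst.comp (Sec.continuous_coords.comp
      ((Units.continuous_val.comp continuous_fst).prodMk continuous_snd))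
  · exact Plus.continuous_fst.comp (Sec.continuous_coords.comp
      ((Units.continuous_val.comp (continuous_inv.comp continuous_fst)).prodMk continuous_snd))

/-- The homomorphism `p_* : GL(A_{ζ⁺}) → C(X, 𝕜 - 0)` induced by `B⁺ → 𝕜`. -/
def glProj : GLsecPlus 𝕜 ζ B →ₜ* C(X, 𝕜ˣ) where
  toFun u := ⟨ζ.descend (unitPart 𝕜 ζ B u),
    (ζ.continuous_descend (continuous_unitPart 𝕜 ζ B) (unitPart_smul 𝕜 ζ B)).comp
      (Continuous.prodMk_right u)⟩
  map_one' := by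
    ext x
    change (Sec.coords (1 : Sec ζ (Plus 𝕜 B)) _).fst = 1
    rw [Sec.coords_one]
    rfl
  map_mul' u v := by
    ext x
    change (Sec.coords (u.val * v.val) _).fst = (u.val.coords _).fst * (v.val.coords _).fst
    rw [Sec.coords_mul]
    rfl
  continuous_toFun := ContinuousMap.continuous_of_continuous_uncurry _
    (ζ.continuous_descend (continuous_unitPart 𝕜 ζ B) (unitPart_smul 𝕜 ζ B))

/-- The section `x ↦ f(x) · 1` of `P ×_G B⁺`. -/
def scalarSec (f : C(X, 𝕜)) : Sec ζ (Plus 𝕜 B) :=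
  Sec.ofEquivariant (fun p => Plus.mk (f (ζ.proj p)) 0)
    (Plus.continuous_rng (f.continuous.comp ζ.continuous_proj) continuous_const)
    fun g p => by
      rw [ζ.proj_smul]
      exact Plus.ext rfl (smul_zero g).symm

theorem coords_scalarSec (f : C(X, 𝕜)) (p : P) :
    (scalarSec 𝕜 ζ B f).coords p = Plus.mk (f (ζ.proj p)) 0 := by
  unfold scalarSec
  rw [Sec.coords_ofEquivariant]

theorem continuous_scalarSec : Continuous (scalarSec 𝕜 ζ B) := by
  refine Sec.continuous_ofEquivariant (T := C(X, 𝕜))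
    (h := fun f p => (Plus.mk (f (ζ.proj p)) 0 : Plus 𝕜 B)) ?_ _ _
  exact Plus.continuous_rng ((continuous_eval (F := C(X, 𝕜))).comp
    (continuous_fst.prodMk (ζ.continuous_proj.comp continuous_snd))) continuous_const

def scalarSecHom : C(X, 𝕜) →* Sec ζ (Plus 𝕜 B) where
  toFun := scalarSec 𝕜 ζ B
  map_one' := Sec.coords_injective (by
    funext p
    rw [coords_scalarSec, Sec.coords_one]
    rfl)
  map_mul' f g := Sec.coords_injective (by
    funext p
    rw [Sec.coords_mul, Pi.mul_apply, coords_scalarSec, coords_scalarSec, coords_scalarSec]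
    refine Plus.ext rfl ?_
    rw [Plus.snd_mul]
    simp [Plus.mk, Plus.snd])

/-- The canonical splitting `C(X, 𝕜 - 0) → GL(A_{ζ⁺})`, `f ↦ f · 1`, of `p_*`. -/
def glScalar : C(X, 𝕜ˣ) →ₜ* GLsecPlus 𝕜 ζ B where
  toFun f := Units.map (scalarSecHom 𝕜 ζ B) (ContinuousMap.unitsLift f)
  map_one' := by
    apply Units.ext
    exact map_one (scalarSecHom 𝕜 ζ B)
  map_mul' f g := by
    apply Units.ext
    exact map_mul (scalarSecHom 𝕜 ζ B) (ContinuousMap.unitsLift f).val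
      (ContinuousMap.unitsLift g).val
  continuous_toFun := by
    have h : Continuous fun f : C(X, 𝕜ˣ) => (ContinuousMap.unitsLift f).val :=
      ContinuousMap.continuous_postcomp (⟨Units.val, Units.continuous_val⟩ : C(𝕜ˣ, 𝕜))
    refine Units.continuous_iff.2 ⟨(continuous_scalarSec 𝕜 ζ B).comp h, ?_⟩
    exact (continuous_scalarSec 𝕜 ζ B).comp (h.comp continuous_inv)

variable {𝕜 B ζ ζ'}

/-- The unital extension `B⁺ → B'⁺` of an equivariant homomorphism `B → B'`. -/
def EquivariantHom.plus (α : EquivariantHom 𝕜 G B B') :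
    EquivariantHom 𝕜 G (Plus 𝕜 B) (Plus 𝕜 B') where
  toHom := (Plus.map α.toHom : Plus 𝕜 B →ₙₐ[𝕜] Plus 𝕜 B')
  continuous := Plus.continuous_map α.toHom α.continuous
  map_smul g b := by
    refine Plus.ext ?_ ?_
    · change Plus.fst (Plus.map α.toHom (g • b)) = Plus.fst (Plus.map α.toHom b)
      rw [Plus.fst_map, Plus.fst_map, Plus.fst_smul]
    · change Plus.snd (Plus.map α.toHom (g • b)) = g • Plus.snd (Plus.map α.toHom b)
      rw [Plus.snd_map, Plus.snd_map, Plus.snd_smul, α.map_smul]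

/-- The homomorphism `GL(A_ζ) → GL(A_{ζ'})` induced by `ζ' → ζ` and `α : B → B'`. -/
def glMap (m : BundleMap ζ' ζ) (α : EquivariantHom 𝕜 G B B') :
    GLsec 𝕜 ζ B →ₜ* GLsec 𝕜 ζ' B' where
  toMonoidHom := ((Units.map (Plus.map (secMap m α) :
      Plus 𝕜 (Sec ζ B) →* Plus 𝕜 (Sec ζ' B'))).comp (GLsec 𝕜 ζ B).subtype).codRestrict
    (GLsec 𝕜 ζ' B') fun u => by
      have hu : Plus.fst u.1.val = 1 := congrArg Units.val u.2
      refine Units.ext ?_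
      change Plus.fst (Plus.map (secMap m α) u.1.val) = 1
      rw [Plus.fst_map, hu]
  continuous_toFun := ((Continuous.units_map _ (Plus.continuous_map _
    (continuous_secMap m α))).comp continuous_subtype_val).subtype_mk _

/-- The homomorphism `GL(A_{ζ⁺}) → GL(A_{ζ'⁺})` induced by `ζ' → ζ` and `α : B → B'`. -/
def glPlusMap (m : BundleMap ζ' ζ) (α : EquivariantHom 𝕜 G B B') :
    GLsecPlus 𝕜 ζ B →ₜ* GLsecPlus 𝕜 ζ' B' where
  toMonoidHom := Units.map
    { toFun := secMap m α.plus
      map_one' := Sec.coords_injective (by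
        funext p
        rw [coords_secMap, Sec.coords_one, Sec.coords_one]
        exact map_one (Plus.map α.toHom))
      map_mul' := map_mul (secMap m α.plus) }
  continuous_toFun := Continuous.units_map _ (continuous_secMap m α.plus)

end Maps

/-- The homomorphism `C(X, 𝕜 - 0) → C(Y, 𝕜 - 0)` induced by `f : Y → X`. -/
def precompHom {X Y : Type*} [TopologicalSpace X] [TopologicalSpace Y] (𝕜 : Type*) [CommRing 𝕜]
    [TopologicalSpace 𝕜] [IsTopologicalRing 𝕜] (f : C(Y, X)) : C(X, 𝕜ˣ) →ₜ* C(Y, 𝕜ˣ) where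
  toMonoidHom := ContinuousMap.compMonoidHom' f
  continuous_toFun := ContinuousMap.continuous_precomp f

/-! ### The maps of the exact sequences -/

section Sequence

variable {G P X : Type*} [Group G] [TopologicalSpace G] [IsTopologicalGroup G]
  [TopologicalSpace P] [TopologicalSpace X] [LocallyCompactSpace X] [MulAction G P]
  [ContinuousSMul G P] (ζ : PrincipalBundle G P X)
  (B : Type*) [NonUnitalRing B] [TopologicalSpace B] [IsTopologicalRing B] [Module ℂ B]
  [IsScalarTower ℂ B B] [SMulCommClass ℂ B B] [ContinuousSMul ℂ B]
  [DistribMulAction G B] [ContinuousSMul G B] [MulAct G B] [SMulCommClass G ℂ B]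

/-- `π₀(GL A_{ζ⁺}) → π₀(C(X, ℂ - 0)) ≅ Ȟ¹(X; ℤ)`. -/
def quot0 (θ : ZerothHomotopy C(X, ℂˣ) ≃* Multiplicative (Cech X 1 ℤ)) :
    ZerothHomotopy (GLsecPlus ℂ ζ B) →* Multiplicative (Cech X 1 ℤ) :=
  θ.toMonoidHom.comp (pi0Hom (glProj ℂ ζ B))

/-- `Ȟ¹(X; ℤ) ≅ π₀(C(X, ℂ - 0)) → π₀(GL A_{ζ⁺})`. -/
def split0 (θ : ZerothHomotopy C(X, ℂˣ) ≃* Multiplicative (Cech X 1 ℤ)) :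
    Multiplicative (Cech X 1 ℤ) →* ZerothHomotopy (GLsecPlus ℂ ζ B) :=
  (pi0Hom (glScalar ℂ ζ B)).comp θ.symm.toMonoidHom

/-- `π₁(GL A_{ζ⁺}) → π₁(C(X, ℂ - 0)) ≅ Ȟ⁰(X; ℤ)`. -/
def quot1 (θ : π_ 1 C(X, ℂˣ) 1 ≃* Multiplicative (Cech X 0 ℤ)) :
    π_ 1 (GLsecPlus ℂ ζ B) 1 →* Multiplicative (Cech X 0 ℤ) :=
  θ.toMonoidHom.comp (piHom 0 (glProj ℂ ζ B))

/-- `Ȟ⁰(X; ℤ) ≅ π₁(C(X, ℂ - 0)) → π₁(GL A_{ζ⁺})`. -/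
def split1 (θ : π_ 1 C(X, ℂˣ) 1 ≃* Multiplicative (Cech X 0 ℤ)) :
    Multiplicative (Cech X 0 ℤ) →* π_ 1 (GLsecPlus ℂ ζ B) 1 :=
  (piHom 0 (glScalar ℂ ζ B)).comp θ.symm.toMonoidHom

end Sequence

/-- `cechMap`, written multiplicatively. -/
def cechMul {X Y : Type*} [TopologicalSpace X] [TopologicalSpace Y] (f : C(Y, X)) (p : ℕ) :
    Multiplicative (Cech X p ℤ) →* Multiplicative (Cech Y p ℤ) :=
  AddMonoidHom.toMultiplicative (cechMap f p ℤ)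

end SectionGL

end

open SectionGL

universe u v w z

noncomputable section

namespace SectionGL

/-! ### Homotopy groups of topological groups: products and splittings -/

section Splitting

open scoped unitInterval Topology.Homotopy

set_option linter.unusedSectionVars false

variable {H K L : Type*} [Group H] [TopologicalSpace H] [IsTopologicalGroup H]
  [Group K] [TopologicalSpace K] [IsTopologicalGroup K]
  [Group L] [TopologicalSpace L] [IsTopologicalGroup L]

/-! The group `GL(A_{ζ⁺})` is the topological direct product of `GL(A_ζ)` and `C(X, 𝔽ˣ)`. The scalar
sections `σ(f)` are central and `p_* ∘ σ = id`, so `u ↦ u · σ(p_* u)⁻¹` is a continuous homomorphism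
onto the kernel of `p_*`. A section in this kernel has the form `1 + b` with `b ∈ A_ζ`, so the
kernel is the image of `ι`, and reading off `b` inverts `ι` continuously (`isTopSplitting_gl`). A
direct product of topological groups splits every homotopy group (`isSplitShortExact_pi0`,
`isSplitShortExact_pi`), and the maps of the splitting used in the theorem commute with bundle maps
and equivariant homomorphisms. It remains to compute the homotopy of `C(X, 𝔽ˣ)`.

For `𝔽 = ℂ` the tool is the covering `z ↦ exp (2πiz)` of `ℂˣ` by `ℂ`. Since `X` is locally compact,
a family of maps `X → ℂˣ` is a map on a product with `X`, and homotopies lift with all of `X` as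
parameter space. A lift of a loop is constant on each connected piece where the loop is trivial. In
dimension at least 2 this forces the lift, normalized at a corner, to vanish on the boundary of the
cube, and a linear homotopy contracts it. In dimension 1 the end value of the lift is a locally
constant integer function, the winding number, which determines the loop up to homotopy. Such
functions form `Ȟ⁰(X; ℤ)`.

For `π₀`, a function lies in the component of `1` exactly when it has a global logarithm. Local
logarithms of any function differ on overlaps by integers, which gives a `1`-cocycle. Conversely a
partition of unity turns each cocycle into local logarithms of some function. The cocycle becomes a
coboundary after refinement exactly when the function has a global logarithm, so `π₀ = Ȟ¹(X; ℤ)`.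

For `𝔽 = ℝ` a loop of positive dimension based at `1` takes only positive values, and a linear
homotopy contracts it. -/

theorem pi0Hom_comp (g : K →ₜ* L) (f : H →ₜ* K) :
    (pi0Hom g).comp (pi0Hom f) = pi0Hom (g.comp f) := by
  ext ⟨x⟩
  rfl

theorem pi0Hom_id : pi0Hom (ContinuousMonoidHom.id H) = MonoidHom.id _ := by
  ext ⟨x⟩
  rfl

theorem piHom_comp (k : ℕ) (g : K →ₜ* L) (f : H →ₜ* K) :
    (piHom k g).comp (piHom k f) = piHom k (g.comp f) := by
  ext ⟨x⟩
  rfl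

theorem piHom_id (k : ℕ) : piHom k (ContinuousMonoidHom.id H) = MonoidHom.id _ := by
  ext ⟨x⟩
  rfl

theorem idComponentMap_comp (g : K →ₜ* L) (f : H →ₜ* K) :
    (idComponentMap g).comp (idComponentMap f) = idComponentMap (g.comp f) := rfl

/-- The pointwise product of two loops in a topological group. -/
def loopMul {N : Type*} (a b : GenLoop N H 1) : GenLoop N H 1 :=
  ⟨a.1 * b.1, fun y hy => by
    have h1 : a.1 y = 1 := a.2 y hy
    have h2 : b.1 y = 1 := b.2 y hy
    simp [h1, h2]⟩

theorem loopMul_apply {N : Type*} (a b : GenLoop N H 1) (y : N → I) :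
    loopMul a b y = a y * b y := rfl

theorem loopMul_homotopic {N : Type*} {a a' b b' : GenLoop N H 1}
    (h₁ : GenLoop.Homotopic a a') (h₂ : GenLoop.Homotopic b b') :
    GenLoop.Homotopic (loopMul a b) (loopMul a' b') := by
  obtain ⟨F⟩ := h₁
  obtain ⟨F'⟩ := h₂
  refine ⟨⟨⟨⟨fun q => F q * F' q, by fun_prop⟩, fun y => ?_, fun y => ?_⟩, fun t y hy => ?_⟩⟩
  · change F (0, y) * F' (0, y) = a.1 y * b.1 y
    rw [F.apply_zero, F'.apply_zero]
  · change F (1, y) * F' (1, y) = a'.1 y * b'.1 y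
    rw [F.apply_one, F'.apply_one]
  · change F (t, y) * F' (t, y) = a.1 y * b.1 y
    rw [F.eq_fst _ hy, F'.eq_fst _ hy]

/-- The class of a loop in the homotopy group. -/
def piMk {n : ℕ} (a : GenLoop (Fin n) H 1) : π_ n H 1 := Quotient.mk _ a

/-- The product in the homotopy groups of a topological group is induced by the pointwise product
of loops. -/
theorem piMk_loopMul (k : ℕ) (a b : GenLoop (Fin (k + 1)) H 1) :
    piMk (loopMul b a) = piMk a * piMk b := by
  -- Eckmann–Hilton: replace `b` by "`b`, then constant" and `a` by "constant, then `a`". The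
  -- pointwise product of these two loops is literally the concatenation of `b` and `a`. The
  -- convention of `HomotopyGroup.mul_spec` makes this concatenation represent `[a][b]`, hence the
  -- reversed order.
  have hab := HomotopyGroup.mul_spec (i := (0 : Fin (k + 1))) (p := a) (q := b)
  have h1b := HomotopyGroup.mul_spec (i := (0 : Fin (k + 1))) (p := GenLoop.const) (q := b)
  have ha1 := HomotopyGroup.mul_spec (i := (0 : Fin (k + 1))) (p := a) (q := GenLoop.const)
  have e1 : piMk (GenLoop.transAt 0 b GenLoop.const) = piMk b := h1b.symm.trans (one_mul _)
  have e2 : piMk (GenLoop.transAt 0 GenLoop.const a) = piMk a := ha1.symm.trans (mul_one _)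
  refine Eq.trans ?_ hab.symm
  refine (Quotient.sound (loopMul_homotopic (Quotient.exact e1) (Quotient.exact e2))).symm.trans ?_
  refine congrArg (Quotient.mk _) ?_
  ext y
  change GenLoop.transAt 0 b GenLoop.const y * GenLoop.transAt 0 GenLoop.const a y =
    GenLoop.transAt 0 b a y
  simp only [GenLoop.transAt, GenLoop.coe_copy]
  split_ifs <;> simp

/-- `K` is the topological direct product of `H` and `L`: the inclusions are `i` and `s`, the
projections `r` and `p`. -/
structure IsTopSplitting (i : H →ₜ* K) (p : K →ₜ* L) (s : L →ₜ* K) (r : K →ₜ* H) : Prop where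
  retract : r.comp i = ContinuousMonoidHom.id H
  proj_incl : ∀ x, p (i x) = 1
  proj_sec : p.comp s = ContinuousMonoidHom.id L
  decomp : ∀ x, i (r x) * s (p x) = x

namespace IsTopSplitting

variable {i : H →ₜ* K} {p : K →ₜ* L} {s : L →ₜ* K} {r : K →ₜ* H}

theorem isSplitShortExact_pi0 (h : IsTopSplitting i p s r) {C : Type*} [Group C]
    (θ : ZerothHomotopy L ≃* C) :
    IsSplitShortExact (pi0Hom i) (θ.toMonoidHom.comp (pi0Hom p))
      ((pi0Hom s).comp θ.symm.toMonoidHom) where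
  injective := by
    refine Function.LeftInverse.injective (g := pi0Hom r) fun x => ?_
    have := DFunLike.congr_fun (pi0Hom_comp r i) x
    rwa [h.retract, pi0Hom_id] at this
  exact := by
    ext x
    constructor
    · rintro ⟨⟨y⟩, rfl⟩
      refine (congrArg θ ?_).trans (map_one θ)
      exact congrArg ZerothHomotopy.mk (h.proj_incl y)
    · intro hx
      have hx' : pi0Hom p x = 1 := (map_eq_one_iff θ θ.injective).1 hx
      refine ⟨pi0Hom r x, ?_⟩
      have hd : pi0Hom i (pi0Hom r x) * pi0Hom s (pi0Hom p x) = x := by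
        obtain ⟨y⟩ := x
        exact congrArg ZerothHomotopy.mk (h.decomp y)
      rwa [hx', map_one, mul_one] at hd
  surjective := by
    refine θ.surjective.comp (Function.RightInverse.surjective (g := pi0Hom s) fun x => ?_)
    have := DFunLike.congr_fun (pi0Hom_comp p s) x
    rwa [h.proj_sec, pi0Hom_id] at this
  splits := by
    ext x
    have := DFunLike.congr_fun (pi0Hom_comp p s) (θ.symm x)
    rw [h.proj_sec, pi0Hom_id] at this
    exact (congrArg θ this).trans (θ.apply_symm_apply x)

theorem piHom_injective (h : IsTopSplitting i p s r) (k : ℕ) :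
    Function.Injective (piHom k i) := by
  refine Function.LeftInverse.injective (g := piHom k r) fun x => ?_
  have := DFunLike.congr_fun (piHom_comp k r i) x
  rwa [h.retract, piHom_id] at this

/-- The decomposition `i (r x) * s (p x) = x` applies to the values of a loop, and pointwise
products of loops induce the product of homotopy classes. -/
theorem piHom_retract_eq (h : IsTopSplitting i p s r) (k : ℕ) {x : π_ (k + 1) K 1}
    (hx : piHom k p x = 1) : piHom k i (piHom k r x) = x := by
  -- The factors are in the opposite order from `decomp` because `piMk_loopMul` reverses them.
  have hd : piHom k s (piHom k p x) * piHom k i (piHom k r x) = x := by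
    obtain ⟨y⟩ := x
    refine (piMk_loopMul k (genLoopMap s (genLoopMap p y)) (genLoopMap i (genLoopMap r y))).symm.trans
      (congrArg (Quotient.mk _) ?_)
    ext t
    exact h.decomp (y t)
  rwa [hx, map_one, one_mul] at hd

theorem isSplitShortExact_pi (h : IsTopSplitting i p s r) (k : ℕ) {C : Type*} [Group C]
    (θ : π_ (k + 1) L 1 ≃* C) :
    IsSplitShortExact (piHom k i) (θ.toMonoidHom.comp (piHom k p))
      ((piHom k s).comp θ.symm.toMonoidHom) where
  injective := h.piHom_injective k
  exact := by
    ext x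
    constructor
    · rintro ⟨⟨y⟩, rfl⟩
      refine (congrArg θ ?_).trans (map_one θ)
      refine congrArg (Quotient.mk _) ?_
      ext t
      exact h.proj_incl (y t)
    · intro hx
      exact ⟨_, h.piHom_retract_eq k ((map_eq_one_iff θ θ.injective).1 hx)⟩
  surjective := by
    refine θ.surjective.comp (Function.RightInverse.surjective (g := piHom k s) fun x => ?_)
    have := DFunLike.congr_fun (piHom_comp k p s) x
    rwa [h.proj_sec, piHom_id] at this
  splits := by
    ext x
    have := DFunLike.congr_fun (piHom_comp k p s) (θ.symm x)
    rw [h.proj_sec, piHom_id] at this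
    exact (congrArg θ this).trans (θ.apply_symm_apply x)

theorem piHom_bijective (h : IsTopSplitting i p s r) (k : ℕ)
    (hL : ∀ a : GenLoop (Fin (k + 1)) L 1, GenLoop.Homotopic a GenLoop.const) :
    Function.Bijective (piHom k i) := by
  refine ⟨h.piHom_injective k, fun x => ⟨_, h.piHom_retract_eq k ?_⟩⟩
  obtain ⟨y⟩ := x
  exact Quotient.sound (hL (genLoopMap p y))

/-- Continuous homomorphisms preserve identity components, so the whole splitting restricts. This
serves the isomorphisms in high degree, which are formulated for `GL_o`. -/
theorem idComponent (h : IsTopSplitting i p s r) :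
    IsTopSplitting (idComponentMap i) (idComponentMap p) (idComponentMap s) (idComponentMap r) where
  retract := by
    ext x
    exact DFunLike.congr_fun h.retract x.1
  proj_incl x := Subtype.ext (h.proj_incl x.1)
  proj_sec := by
    ext x
    exact DFunLike.congr_fun h.proj_sec x.1
  decomp x := Subtype.ext (h.decomp x.1)

end IsTopSplitting

/-- A null homotopy of a loop in the identity component stays in the identity component. -/
theorem homotopic_const_idComponent {N : Type*}
    (hL : ∀ a : GenLoop N L 1, GenLoop.Homotopic a GenLoop.const)
    (a : GenLoop N (idComponent L) 1) : GenLoop.Homotopic a GenLoop.const := by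
  obtain ⟨F⟩ := hL ⟨⟨fun y => (a y : L), by fun_prop⟩, fun y hy => by
    have h : a.1 y = 1 := a.2 y hy
    exact congrArg Subtype.val h⟩
  have hF : ∀ q, F q ∈ idComponent L := by
    rintro ⟨t, y⟩
    -- At time `0` the homotopy takes values of the given loop, which lie in the component; letting
    -- time run from `0` to `t` joins these to `F (t, y)`.
    have h0 : Joined (1 : L) (F (0, y)) := by
      rw [F.apply_zero]
      exact (a y).2
    refine h0.trans ?_
    refine joined_map (f := fun t => F (t, y)) (by fun_prop) ?_
    exact ⟨⟨⟨fun s => s * t, by fun_prop⟩, zero_mul t, one_mul t⟩⟩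
  refine ⟨⟨⟨⟨fun q => ⟨F q, hF q⟩, by fun_prop⟩, fun y => ?_, fun y => ?_⟩, fun t y hy => ?_⟩⟩
  · exact Subtype.ext (F.apply_zero y)
  · exact Subtype.ext (F.apply_one y)
  · exact Subtype.ext (F.eq_fst t hy)

end Splitting

/-! ### The splitting of the group of invertible sections -/

section Retraction

set_option linter.unusedSectionVars false

variable {G P X P' X' : Type*} [Group G] [TopologicalSpace G] [IsTopologicalGroup G]
  [TopologicalSpace P] [TopologicalSpace X] [MulAction G P] [ContinuousSMul G P]
  [TopologicalSpace P'] [TopologicalSpace X'] [MulAction G P'] [ContinuousSMul G P']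
  {𝕜 : Type*} [CommRing 𝕜] [TopologicalSpace 𝕜] [IsTopologicalRing 𝕜]
  [LocallyCompactSpace X] [LocallyCompactSpace X']
  {ζ : PrincipalBundle G P X} {ζ' : PrincipalBundle G P' X'}
  {B B' : Type*} [NonUnitalRing B] [TopologicalSpace B] [IsTopologicalRing B] [Module 𝕜 B]
  [IsScalarTower 𝕜 B B] [SMulCommClass 𝕜 B B] [ContinuousSMul 𝕜 B]
  [DistribMulAction G B] [ContinuousSMul G B] [MulAct G B] [SMulCommClass G 𝕜 B]
  [NonUnitalRing B'] [TopologicalSpace B'] [IsTopologicalRing B'] [Module 𝕜 B']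
  [IsScalarTower 𝕜 B' B'] [SMulCommClass 𝕜 B' B'] [ContinuousSMul 𝕜 B']
  [DistribMulAction G B'] [ContinuousSMul G B'] [MulAct G B'] [SMulCommClass G 𝕜 B']

theorem glSecPlus_ext {u v : GLsecPlus 𝕜 ζ B} (h : ∀ p, u.val.coords p = v.val.coords p) :
    u = v :=
  Units.ext (Sec.coords_injective (funext h))

/-- Membership in `GL(A_ζ)` fixes the scalar part to be `1`, so only the component in `A_ζ` has to
be compared. -/
theorem glSec_ext {u v : GLsec 𝕜 ζ B}
    (h : ∀ p, (Plus.snd u.1.val).coords p = (Plus.snd v.1.val).coords p) : u = v := by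
  refine Subtype.ext (Units.ext (Plus.ext ?_ (Sec.coords_injective (funext h))))
  have hu : Plus.fst u.1.val = 1 := congrArg Units.val u.2
  have hv : Plus.fst v.1.val = 1 := congrArg Units.val v.2
  rw [hu, hv]

theorem coords_glSecPlus_mul (u v : GLsecPlus 𝕜 ζ B) (p : P) :
    (u * v).val.coords p = u.val.coords p * v.val.coords p :=
  congrFun (Sec.coords_mul u.val v.val) p

theorem coords_glScalar (f : C(X, 𝕜ˣ)) (p : P) :
    (glScalar 𝕜 ζ B f).val.coords p = Plus.mk (f (ζ.proj p) : 𝕜) 0 :=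
  coords_scalarSec 𝕜 ζ B _ p

theorem glProj_proj (u : GLsecPlus 𝕜 ζ B) (p : P) :
    (glProj 𝕜 ζ B u (ζ.proj p) : 𝕜) = (u.val.coords p).fst :=
  congrArg Units.val (ζ.descend_proj (unitPart_smul 𝕜 ζ B u) p)

theorem coords_glIncl (u : GLsec 𝕜 ζ B) (p : P) :
    (glIncl 𝕜 ζ B u).val.coords p = Plus.mk 1 ((Plus.snd u.1.val).coords p) := by
  have hu : Plus.fst u.1.val = 1 := congrArg Units.val u.2
  change (algebraMap 𝕜 (Sec ζ (Plus 𝕜 B)) (Plus.fst u.1.val) +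
    secMap (BundleMap.id ζ) (inclPlus 𝕜 B) (Plus.snd u.1.val)).coords p = _
  rw [hu, map_one, Sec.coords_add, Pi.add_apply, Sec.coords_one, coords_secMap]
  exact Plus.ext (add_zero 1) (zero_add _)

theorem glProj_eq_iff {u : GLsecPlus 𝕜 ζ B} {f : C(X, 𝕜ˣ)} :
    glProj 𝕜 ζ B u = f ↔ ∀ p, (u.val.coords p).fst = f (ζ.proj p) := by
  constructor
  · rintro rfl p
    exact (glProj_proj u p).symm
  · intro h
    ext x
    obtain ⟨p, rfl⟩ := ζ.proj_surjective x
    rw [glProj_proj, h]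

theorem glProj_glScalar (f : C(X, 𝕜ˣ)) : glProj 𝕜 ζ B (glScalar 𝕜 ζ B f) = f :=
  glProj_eq_iff.2 fun p => by
    rw [coords_glScalar]
    rfl

theorem glProj_glIncl (u : GLsec 𝕜 ζ B) : glProj 𝕜 ζ B (glIncl 𝕜 ζ B u) = 1 :=
  glProj_eq_iff.2 fun p => by
    rw [coords_glIncl]
    rfl

/-- Centrality of the scalars is what makes `glNormalize` multiplicative, and so makes the product
direct rather than semidirect. -/
theorem glScalar_mul_comm (f : C(X, 𝕜ˣ)) (u : GLsecPlus 𝕜 ζ B) :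
    glScalar 𝕜 ζ B f * u = u * glScalar 𝕜 ζ B f :=
  glSecPlus_ext fun p => by
    rw [coords_glSecPlus_mul, coords_glSecPlus_mul, coords_glScalar]
    refine Plus.ext (mul_comm _ _) ?_
    rw [Plus.snd_mul, Plus.snd_mul]
    simp [Plus.mk, Plus.snd, Plus.fst]

variable (𝕜 ζ B) in
/-- `u ↦ u · p(u)⁻¹`, the projection of `GL(A_{ζ⁺})` onto the kernel of `p_*`. -/
def glNormalize : GLsecPlus 𝕜 ζ B →ₜ* GLsecPlus 𝕜 ζ B where
  toFun u := u * (glScalar 𝕜 ζ B (glProj 𝕜 ζ B u))⁻¹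
  map_one' := by simp
  map_mul' u v := by
    have hc : (glScalar 𝕜 ζ B (glProj 𝕜 ζ B u))⁻¹ * v = v * (glScalar 𝕜 ζ B (glProj 𝕜 ζ B u))⁻¹ :=
      Commute.inv_left (glScalar_mul_comm _ v)
    rw [map_mul, mul_comm (glProj 𝕜 ζ B u), map_mul, mul_inv_rev, mul_assoc u _ (v * _),
      ← mul_assoc _ v, hc]
    simp only [mul_assoc]
  continuous_toFun := continuous_id.mul
    ((map_continuous (glScalar 𝕜 ζ B)).comp (map_continuous (glProj 𝕜 ζ B))).inv

theorem glNormalize_apply (u : GLsecPlus 𝕜 ζ B) :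
    glNormalize 𝕜 ζ B u = u * (glScalar 𝕜 ζ B (glProj 𝕜 ζ B u))⁻¹ := rfl

theorem fst_glNormalize (u : GLsecPlus 𝕜 ζ B) (p : P) :
    ((glNormalize 𝕜 ζ B u).val.coords p).fst = 1 := by
  have h : glProj 𝕜 ζ B (glNormalize 𝕜 ζ B u) = 1 := by
    rw [glNormalize_apply, map_mul, map_inv, glProj_glScalar, mul_inv_cancel]
  exact glProj_eq_iff.1 h p

theorem continuous_snd_coords (s : Sec ζ (Plus 𝕜 B)) :
    Continuous fun p => (s.coords p).snd :=
  Plus.continuous_snd.comp s.continuous_coords_apply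

theorem snd_coords_smul (s : Sec ζ (Plus 𝕜 B)) (g : G) (p : P) :
    (s.coords (g • p)).snd = g • (s.coords p).snd := by
  rw [Sec.coords_smul, Plus.snd_smul]

/-- The element `1 + b` of `(A_ζ)⁺`, where `b` is the component in `A_ζ` of a section of
`P ×_G B⁺`. -/
def onePlus (s : Sec ζ (Plus 𝕜 B)) : Plus 𝕜 (Sec ζ B) :=
  Plus.mk 1 (Sec.ofEquivariant (fun p => (s.coords p).snd) (continuous_snd_coords s)
    (snd_coords_smul s))

theorem coords_snd_onePlus (s : Sec ζ (Plus 𝕜 B)) (p : P) :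
    (Plus.snd (onePlus s)).coords p = (s.coords p).snd :=
  congrFun (Sec.coords_ofEquivariant (ζ := ζ) (fun p => (s.coords p).snd)
    (continuous_snd_coords s) (snd_coords_smul s)) p

theorem continuous_onePlus :
    Continuous (onePlus : Sec ζ (Plus 𝕜 B) → Plus 𝕜 (Sec ζ B)) := by
  refine Plus.continuous_rng continuous_const ?_
  exact Sec.continuous_ofEquivariant (T := Sec ζ (Plus 𝕜 B))
    (h := fun s p => (s.coords p).snd) (Plus.continuous_snd.comp Sec.continuous_coords)
    continuous_snd_coords snd_coords_smul

theorem onePlus_one : onePlus (1 : Sec ζ (Plus 𝕜 B)) = 1 := by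
  refine Plus.ext rfl (Sec.coords_injective (funext fun p => ?_))
  rw [coords_snd_onePlus, Sec.coords_one]
  exact (congrFun (Sec.coords_zero (ζ := ζ) (F := B)) p).symm

/-- `onePlus` overwrites the scalar part by `1`, so it respects products only of sections whose
scalar part is already `1`. This is why it is applied after `glNormalize`. -/
theorem onePlus_mul {s t : Sec ζ (Plus 𝕜 B)} (hs : ∀ p, (s.coords p).fst = 1)
    (ht : ∀ p, (t.coords p).fst = 1) : onePlus (s * t) = onePlus s * onePlus t := by
  refine Plus.ext (one_mul (1 : 𝕜)).symm (Sec.coords_injective (funext fun p => ?_))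
  rw [coords_snd_onePlus, Sec.coords_mul, Pi.mul_apply, Plus.snd_mul, hs, ht, Plus.snd_mul]
  change _ = ((1 : 𝕜) • (onePlus t).snd + (1 : 𝕜) • (onePlus s).snd +
    (onePlus s).snd * (onePlus t).snd).coords p
  rw [one_smul, one_smul, one_smul, one_smul, Sec.coords_add, Sec.coords_add, Sec.coords_mul]
  simp only [Pi.add_apply, Pi.mul_apply, coords_snd_onePlus]

theorem onePlus_glNormalize_mul (u v : GLsecPlus 𝕜 ζ B) :
    onePlus (glNormalize 𝕜 ζ B (u * v)).val =
      onePlus (glNormalize 𝕜 ζ B u).val * onePlus (glNormalize 𝕜 ζ B v).val := by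
  rw [map_mul]
  exact onePlus_mul (fst_glNormalize u) (fst_glNormalize v)

theorem onePlus_glNormalize_one :
    onePlus (glNormalize 𝕜 ζ B 1).val = 1 := by
  rw [map_one]
  exact onePlus_one

variable (𝕜 ζ B) in
/-- The retraction of `GL(A_{ζ⁺})` onto `GL(A_ζ)`. -/
def glRetract : GLsecPlus 𝕜 ζ B →ₜ* GLsec 𝕜 ζ B where
  -- The inverse is obtained by applying the same construction to `u⁻¹`; both inverse laws reduce to
  -- multiplicativity.
  toFun u := ⟨⟨onePlus (glNormalize 𝕜 ζ B u).val, onePlus (glNormalize 𝕜 ζ B u⁻¹).val,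
    by rw [← onePlus_glNormalize_mul, mul_inv_cancel, onePlus_glNormalize_one],
    by rw [← onePlus_glNormalize_mul, inv_mul_cancel, onePlus_glNormalize_one]⟩, Units.ext rfl⟩
  map_one' := Subtype.ext (Units.ext onePlus_glNormalize_one)
  map_mul' u v := Subtype.ext (Units.ext (onePlus_glNormalize_mul u v))
  continuous_toFun := by
    have h : Continuous fun u : GLsecPlus 𝕜 ζ B => onePlus (glNormalize 𝕜 ζ B u).val :=
      continuous_onePlus.comp
        (Units.continuous_val.comp (map_continuous (glNormalize 𝕜 ζ B)))
    exact (Units.continuous_iff.2 ⟨h, h.comp continuous_inv⟩).subtype_mk _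

theorem coords_snd_glRetract (u : GLsecPlus 𝕜 ζ B) (p : P) :
    (Plus.snd (glRetract 𝕜 ζ B u).1.val).coords p =
      ((glNormalize 𝕜 ζ B u).val.coords p).snd :=
  coords_snd_onePlus _ p

theorem glIncl_glRetract (u : GLsecPlus 𝕜 ζ B) :
    glIncl 𝕜 ζ B (glRetract 𝕜 ζ B u) = glNormalize 𝕜 ζ B u :=
  glSecPlus_ext fun p => by
    rw [coords_glIncl, coords_snd_glRetract]
    exact Plus.ext (fst_glNormalize u p).symm rfl

variable (𝕜 ζ B) in
-- On `GL(A_ζ)` the scalar part is trivial, so normalizing changes nothing and the retraction is the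
-- identity there. The decomposition is `u = (u · σ(p u)⁻¹) · σ(p u)`.
theorem isTopSplitting_gl : IsTopSplitting (glIncl 𝕜 ζ B) (glProj 𝕜 ζ B) (glScalar 𝕜 ζ B)
    (glRetract 𝕜 ζ B) where
  retract := by
    ext1 u
    refine glSec_ext fun p => ?_
    change (Plus.snd (glRetract 𝕜 ζ B (glIncl 𝕜 ζ B u)).1.val).coords p = _
    rw [coords_snd_glRetract, glNormalize_apply, glProj_glIncl, map_one, inv_one, mul_one,
      coords_glIncl]
    rfl
  proj_incl := glProj_glIncl
  proj_sec := by
    ext1 f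
    exact glProj_glScalar f
  decomp u := by
    rw [glIncl_glRetract, glNormalize_apply, inv_mul_cancel_right]

/-! ### Naturality -/

variable (m : BundleMap ζ' ζ) (α : EquivariantHom 𝕜 G B B')

theorem coords_glPlusMap (u : GLsecPlus 𝕜 ζ B) (p : P') :
    (glPlusMap m α u).val.coords p = Plus.map α.toHom (u.val.coords (m.total p)) :=
  coords_secMap m α.plus u.val p

theorem glIncl_comp_glMap :
    (glIncl 𝕜 ζ' B').comp (glMap m α) = (glPlusMap m α).comp (glIncl 𝕜 ζ B) := by
  ext1 u
  refine glSecPlus_ext fun p => ?_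
  change (glIncl 𝕜 ζ' B' (glMap m α u)).val.coords p =
    (glPlusMap m α (glIncl 𝕜 ζ B u)).val.coords p
  rw [coords_glIncl, coords_glPlusMap, coords_glIncl]
  change Plus.mk 1 ((Plus.map (secMap m α) u.1.val).snd.coords p) = _
  rw [Plus.snd_map, coords_secMap]
  refine Plus.ext ?_ ?_
  · rw [Plus.fst_map]
    rfl
  · rw [Plus.snd_map]
    rfl

theorem glProj_comp_glPlusMap :
    (glProj 𝕜 ζ' B').comp (glPlusMap m α) = (precompHom 𝕜 m.base).comp (glProj 𝕜 ζ B) := by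
  ext1 u
  refine glProj_eq_iff.2 fun p => ?_
  change ((glPlusMap m α u).val.coords p).fst = (glProj 𝕜 ζ B u (m.base (ζ'.proj p)) : 𝕜)
  rw [coords_glPlusMap, Plus.fst_map, ← m.proj_total, glProj_proj]

theorem glScalar_comp_precompHom :
    (glScalar 𝕜 ζ' B').comp (precompHom 𝕜 m.base) = (glPlusMap m α).comp (glScalar 𝕜 ζ B) := by
  ext1 f
  refine glSecPlus_ext fun p => ?_
  change (glScalar 𝕜 ζ' B' (precompHom 𝕜 m.base f)).val.coords p =
    (glPlusMap m α (glScalar 𝕜 ζ B f)).val.coords p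
  rw [coords_glScalar, coords_glPlusMap, coords_glScalar]
  refine Plus.ext ?_ ?_
  · rw [Plus.fst_map]
    exact congrArg (fun x => (f x : 𝕜)) (m.proj_total p).symm
  · rw [Plus.snd_map]
    exact (map_zero α.toHom).symm

end Retraction

/-! ### The covering `z ↦ exp (2πiz)` -/

section Exponential

open scoped unitInterval Topology.Homotopy

/-- The homomorphism `z ↦ exp (2πiz)` from `ℂ` to `ℂˣ`. -/
def unitExp (z : ℂ) : ℂˣ := Units.mk0 (Complex.exp (2 * Real.pi * Complex.I * z))
  (Complex.exp_ne_zero _)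

theorem val_unitExp (z : ℂ) : (unitExp z : ℂ) = Complex.exp (2 * Real.pi * Complex.I * z) := rfl

theorem unitExp_add (z w : ℂ) : unitExp (z + w) = unitExp z * unitExp w := by
  ext
  simp [val_unitExp, mul_add, Complex.exp_add]

theorem unitExp_zero : unitExp 0 = 1 := by
  ext
  simp [val_unitExp]

theorem unitExp_neg (z : ℂ) : unitExp (-z) = (unitExp z)⁻¹ := by
  rw [eq_inv_iff_mul_eq_one, ← unitExp_add, neg_add_cancel, unitExp_zero]

theorem unitExp_sub (z w : ℂ) : unitExp (z - w) = unitExp z / unitExp w := by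
  rw [sub_eq_add_neg, unitExp_add, unitExp_neg, div_eq_mul_inv]

theorem unitExp_eq_one_iff {z : ℂ} : unitExp z = 1 ↔ ∃ n : ℤ, z = n := by
  rw [Units.ext_iff, val_unitExp, Units.val_one, Complex.exp_eq_one_iff]
  refine exists_congr fun n => ?_
  rw [mul_comm]
  exact mul_left_inj' Complex.two_pi_I_ne_zero

theorem unitExp_intCast (n : ℤ) : unitExp n = 1 := unitExp_eq_one_iff.2 ⟨n, rfl⟩

theorem unitExp_eq_iff {z w : ℂ} : unitExp z = unitExp w ↔ ∃ n : ℤ, z - w = n := by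
  rw [← unitExp_eq_one_iff, unitExp_sub, div_eq_one]

/-- The complex exponential is a covering of the nonzero numbers; rescaling the source by `2πi` and
identifying the target with `ℂˣ` are homeomorphisms. -/
theorem isCoveringMap_unitExp : IsCoveringMap unitExp := by
  have h := (Complex.isCoveringMap_exp.comp_homeomorph
    (Homeomorph.mulLeft₀ (2 * Real.pi * Complex.I) Complex.two_pi_I_ne_zero)).homeomorph_comp
    (unitsHomeomorphNeZero (G₀ := ℂ)).symm
  convert h using 1
  funext z
  apply (unitsHomeomorphNeZero (G₀ := ℂ)).injective
  simp only [Function.comp_apply, Homeomorph.apply_symm_apply]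
  rfl

@[fun_prop]
theorem continuous_unitExp : Continuous unitExp := isCoveringMap_unitExp.continuous

/-- Uniqueness of lifts, compared with a constant lift. It freezes a lift wherever the lifted map is
constant. -/
theorem eq_of_unitExp_eq {A : Type*} [TopologicalSpace A] [PreconnectedSpace A] {g : A → ℂ}
    (hg : Continuous g) {c : ℂˣ} (h : ∀ a, unitExp (g a) = c) (a b : A) : g a = g b := by
  have := isCoveringMap_unitExp.eq_of_comp_eq hg (continuous_const (y := g b))
    (funext fun x => (h x).trans (h b).symm) b rfl
  exact congrFun this a

/-- The covering homotopy property holds for any parameter space `A`; below, `A` is `X` or the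
product of a cube with `X`. -/
theorem exists_lift_unitExp {A : Type*} [TopologicalSpace A] (F : C(I × A, ℂˣ)) (g : C(A, ℂ))
    (h : ∀ a, F (0, a) = unitExp (g a)) :
    ∃ F' : C(I × A, ℂ), (∀ q, unitExp (F' q) = F q) ∧ ∀ a, F' (0, a) = g a :=
  ⟨isCoveringMap_unitExp.liftHomotopy F g h,
    fun q => congrFun (isCoveringMap_unitExp.liftHomotopy_lifts F g h) q,
    isCoveringMap_unitExp.liftHomotopy_zero F g h⟩

variable {X : Type*} [TopologicalSpace X]

/-- Scale the logarithm `g` linearly from `0` to `1`. -/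
theorem joined_of_eq_unitExp {f f' : C(X, ℂˣ)} {g : X → ℂ} (hg : Continuous g)
    (h : ∀ x, f' x = unitExp (g x) * f x) : Joined f f' := by
  refine ⟨⟨⟨fun t => ⟨fun x => unitExp (t * g x) * f x, by fun_prop⟩, ?_⟩, ?_, ?_⟩⟩
  · refine ContinuousMap.continuous_of_continuous_uncurry _ ?_
    change Continuous fun q : I × X => unitExp (q.1 * g q.2) * f q.2
    fun_prop
  · ext x
    simp [unitExp_zero]
  · ext x
    simp [h]

/-- The path is a homotopy on `I × X`. Lift it starting from the logarithm `0` of `1`; the end of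
the lift is a logarithm of `f`. -/
theorem exists_eq_unitExp_of_joined [LocallyCompactSpace X] {f : C(X, ℂˣ)} (h : Joined 1 f) :
    ∃ g : C(X, ℂ), ∀ x, f x = unitExp (g x) := by
  obtain ⟨γ⟩ := h
  obtain ⟨F, hF, -⟩ := exists_lift_unitExp (A := X)
    ⟨fun q => γ q.1 q.2, by fun_prop⟩ 0 fun x => by simp [unitExp_zero]
  refine ⟨⟨fun x => F (1, x), by fun_prop⟩, fun x => ?_⟩
  have := hF (1, x)
  simp only [ContinuousMap.coe_mk, Path.target] at this ⊢
  exact this.symm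

end Exponential

/-! ### Loops in `C(X, ℂˣ)` and `C(X, ℝˣ)` -/

section Loops

open scoped unitInterval Topology.Homotopy

variable {X : Type*} [TopologicalSpace X]

/-- Interpolate linearly between the lifts. Where they agree the interpolation is stationary, so the
homotopy is relative to the boundary. -/
theorem homotopic_of_lifts {n : ℕ} {a b : GenLoop (Fin n) C(X, ℂˣ) 1}
    {g g' : C((Fin n → I) × X, ℂ)} (hg : ∀ y x, unitExp (g (y, x)) = a y x)
    (hg' : ∀ y x, unitExp (g' (y, x)) = b y x)
    (h : ∀ y ∈ Cube.boundary (Fin n), ∀ x, g (y, x) = g' (y, x)) : GenLoop.Homotopic a b := by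
  refine ⟨⟨⟨⟨fun q => ⟨fun x => unitExp (g (q.2, x) + q.1 * (g' (q.2, x) - g (q.2, x))),
    by fun_prop⟩, ?_⟩, fun y => ?_, fun y => ?_⟩, fun t y hy => ?_⟩⟩
  · refine ContinuousMap.continuous_of_continuous_uncurry _ ?_
    change Continuous fun q : (I × (Fin n → I)) × X =>
      unitExp (g (q.1.2, q.2) + q.1.1 * (g' (q.1.2, q.2) - g (q.1.2, q.2)))
    fun_prop
  · ext x
    simp [hg]
  · ext x
    simp [hg']
  · ext x
    simp [← hg, h y hy]

/-- Shrinking the cube to the corner `0` gives a homotopy `t ↦ a (t y)` starting at the constant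
`1`. Lift it from `0` and take the end `t = 1`. -/
theorem exists_lift_genLoop [LocallyCompactSpace X] {n : ℕ} (hn : 0 < n)
    (a : GenLoop (Fin n) C(X, ℂˣ) 1) :
    ∃ g : C((Fin n → I) × X, ℂ), (∀ y x, unitExp (g (y, x)) = a y x) ∧ ∀ x, g (0, x) = 0 := by
  have h0 : a 0 = 1 := a.2 0 ⟨⟨0, hn⟩, Or.inl rfl⟩
  obtain ⟨F, hF, hF0⟩ := exists_lift_unitExp (A := (Fin n → I) × X)
    ⟨fun q => a (fun i => q.1 * q.2.1 i) q.2.2, by fun_prop⟩ 0 fun q => by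
      simp only [ContinuousMap.coe_mk, zero_mul, ContinuousMap.zero_apply, unitExp_zero]
      exact DFunLike.congr_fun h0 q.2
  refine ⟨⟨fun q => F (1, q), by fun_prop⟩, fun y x => ?_, fun x => ?_⟩
  · simpa using hF (1, (y, x))
  -- The corner does not move under the shrinking, so the lift over it keeps its initial value.
  · have := eq_of_unitExp_eq (g := fun t : I => F (t, (0, x))) (by fun_prop) (c := 1)
      (fun t => by
        rw [hF]
        simp only [ContinuousMap.coe_mk, Pi.zero_apply, mul_zero]
        exact DFunLike.congr_fun h0 x) 1 0
    exact this.trans (hF0 _)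

/-- For `n ≥ 2` every `n`-dimensional loop in `C(X, ℂˣ)` is null-homotopic. -/
theorem homotopic_const_complex [LocallyCompactSpace X] {k : ℕ} (hk : 2 ≤ k + 1)
    (a : GenLoop (Fin (k + 1)) C(X, ℂˣ) 1) : GenLoop.Homotopic a GenLoop.const := by
  obtain ⟨g, hg, hg0⟩ := exists_lift_genLoop k.succ_pos a
  refine homotopic_of_lifts (g' := 0) hg (fun y x => by simp [unitExp_zero]) ?_
  -- The loop is trivial on each face of the cube, so the lift is constant there. The face is
  -- parametrized by the whole cube through `Function.update`, which makes its connectedness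
  -- automatic.
  have key : ∀ (i : Fin (k + 1)) (c : I), (c = 0 ∨ c = 1) → ∀ x y y',
      g (Function.update y i c, x) = g (Function.update y' i c, x) := by
    intro i c hc x y y'
    refine eq_of_unitExp_eq (g := fun y => g (Function.update y i c, x)) ?_ (c := 1) ?_ y y'
    · have : Continuous fun y : Fin (k + 1) → I => Function.update y i c :=
        continuous_id.update i continuous_const
      fun_prop
    · intro y
      rw [hg]
      have h1 : a (Function.update y i c) = 1 := a.2 _ ⟨i, by simpa using hc⟩
      rw [h1]
      rfl
  rintro y ⟨i, hi⟩ x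
  -- A second coordinate direction is where dimension at least 2 enters. On the face of `y`, move to
  -- the point with all other coordinates `0`; that point lies on the face `j = 0`, which contains
  -- the corner where the lift vanishes.
  obtain ⟨j, hj⟩ : ∃ j : Fin (k + 1), j ≠ i := by
    have : Nontrivial (Fin (k + 1)) := Fin.nontrivial_iff_two_le.2 hk
    exact exists_ne i
  have h1 := key i (y i) hi x y 0
  rw [Function.update_eq_self] at h1
  have h2 := key j 0 (Or.inl rfl) x (Function.update 0 i (y i)) 0
  have h3 : Function.update (Function.update (0 : Fin (k + 1) → I) i (y i)) j 0 =
      Function.update (0 : Fin (k + 1) → I) i (y i) := by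
    rw [Function.update_eq_iff]
    simp [Function.update_of_ne hj]
  have h4 : Function.update (0 : Fin (k + 1) → I) j 0 = 0 := Function.update_eq_self j 0
  rw [h3, h4, hg0] at h2
  exact h1.trans h2

/-- Every loop of positive dimension in `C(X, ℝˣ)` is null-homotopic. -/
theorem homotopic_const_real [LocallyCompactSpace X] {k : ℕ}
    (a : GenLoop (Fin (k + 1)) C(X, ℝˣ) 1) : GenLoop.Homotopic a GenLoop.const := by
  have h0 : a 0 = 1 := a.2 0 ⟨0, Or.inl rfl⟩
  have hc : Continuous fun q : (Fin (k + 1) → I) × X => (a q.1 q.2 : ℝ) :=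
    Units.continuous_val.comp (by fun_prop)
  -- The cube is connected and the value at the corner is `1`, so a nonpositive value would force a
  -- zero.
  have hpos : ∀ y x, 0 < (a y x : ℝ) := by
    intro y x
    by_contra hy
    have hx : Continuous fun y => (a y x : ℝ) := hc.comp (Continuous.prodMk_left x)
    have h01 : (a 0 x : ℝ) = 1 := by
      rw [h0]
      rfl
    obtain ⟨z, hz⟩ := mem_range_of_exists_le_of_exists_ge hx (c := 0) ⟨y, not_lt.1 hy⟩
      ⟨0, by rw [h01]; exact zero_le_one⟩
    exact (a z x).ne_zero hz
  -- A convex combination of a positive number and `1` does not vanish, so the linear homotopy to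
  -- `1` stays in the units.
  have hne : ∀ (q : I × (Fin (k + 1) → I)) (x : X),
      (1 - q.1 : ℝ) * (a q.2 x : ℝ) + q.1 ≠ 0 := by
    intro q x
    have h1 := hpos q.2 x
    have h2 := q.1.2.1
    have h3 := q.1.2.2
    rcases h2.eq_or_lt with h | h
    · rw [← h]
      simp
    · have := mul_nonneg (sub_nonneg.2 h3) h1.le
      positivity
  have hcont : Continuous fun q : (I × (Fin (k + 1) → I)) × X =>
      Units.mk0 ((1 - q.1.1 : ℝ) * (a q.1.2 q.2 : ℝ) + q.1.1) (hne q.1 q.2) := by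
    refine Units.isEmbedding_val₀.continuous_iff.2 ?_
    change Continuous fun q : (I × (Fin (k + 1) → I)) × X =>
      (1 - q.1.1 : ℝ) * (a q.1.2 q.2 : ℝ) + q.1.1
    have : Continuous fun q : (I × (Fin (k + 1) → I)) × X => (a q.1.2 q.2 : ℝ) :=
      hc.comp (f := fun q : (I × (Fin (k + 1) → I)) × X => (q.1.2, q.2)) (by fun_prop)
    fun_prop
  refine ⟨⟨⟨⟨fun q => ⟨fun x => Units.mk0 ((1 - q.1 : ℝ) * (a q.2 x : ℝ) + q.1) (hne q x),
    hcont.comp (Continuous.prodMk_right q)⟩, ?_⟩, fun y => ?_, fun y => ?_⟩, fun t y hy => ?_⟩⟩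
  · exact ContinuousMap.continuous_of_continuous_uncurry _ hcont
  · ext x
    simp
  · ext x
    simp
  · have h1 : a.1 y = 1 := a.2 y hy
    have h2 : a y = 1 := h1
    ext x
    simp [h2]

end Loops

/-! ### The fundamental group of `C(X, ℂˣ)` -/

section FundamentalGroup

open scoped unitInterval Topology.Homotopy

variable {X Y : Type*} [TopologicalSpace X] [TopologicalSpace Y]

/-- The loop `t ↦ exp (2πi t n)` in `C(X, ℂˣ)`. -/
def expLoop (n : LocallyConstant X ℤ) : GenLoop (Fin 1) C(X, ℂˣ) 1 :=
  ⟨⟨fun y => ⟨fun x => unitExp ((y 0 : ℝ) * (n x : ℂ)), by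
      have := n.continuous
      fun_prop⟩, by
    refine ContinuousMap.continuous_of_continuous_uncurry _ ?_
    change Continuous fun q : (Fin 1 → I) × X => unitExp ((q.1 0 : ℝ) * (n q.2 : ℂ))
    have := n.continuous
    fun_prop⟩, by
    rintro y ⟨i, hi⟩
    rw [Subsingleton.elim i 0] at hi
    ext1 x
    change unitExp ((y 0 : ℝ) * (n x : ℂ)) = 1
    rcases hi with hi | hi
    · simp [hi, unitExp_zero]
    · simp [hi, unitExp_intCast]⟩

theorem expLoop_apply (n : LocallyConstant X ℤ) (y : Fin 1 → I) (x : X) :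
    expLoop n y x = unitExp ((y 0 : ℝ) * (n x : ℂ)) := rfl

/-- The factors are written in reverse order to match `piMk_loopMul`. -/
theorem expLoop_add (m n : LocallyConstant X ℤ) :
    expLoop (m + n) = loopMul (expLoop n) (expLoop m) := by
  ext y x : 2
  rw [loopMul_apply, ContinuousMap.mul_apply, expLoop_apply, expLoop_apply, expLoop_apply,
    ← unitExp_add]
  congr 1
  push_cast [LocallyConstant.add_apply]
  ring

variable (X) in
/-- The homomorphism `C(X, ℤ) → π₁ C(X, ℂˣ)`, `n ↦ [t ↦ exp (2πi t n)]`. -/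
def expLoopHom : Multiplicative (LocallyConstant X ℤ) →* π_ 1 C(X, ℂˣ) 1 :=
  MonoidHom.mk' (fun n => piMk (expLoop n.toAdd)) fun m n => by
    rw [toAdd_mul, expLoop_add, piMk_loopMul]

/-- Lift a null homotopy, starting from the linear lift `y n(x)`. The end of the lift covers the
constant `1`, so it is constant in `y`, while its values at the two ends of the interval are still
`0` and `n(x)`. -/
theorem expLoopHom_injective [LocallyCompactSpace X] : Function.Injective (expLoopHom X) := by
  rw [injective_iff_map_eq_one]
  intro n hn
  obtain ⟨F⟩ : GenLoop.Homotopic (expLoop n.toAdd) GenLoop.const := Quotient.exact hn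
  have hn := n.toAdd.continuous
  obtain ⟨F', hF, hF0⟩ := exists_lift_unitExp (A := (Fin 1 → I) × X)
    ⟨fun q => F (q.1, q.2.1) q.2.2, by fun_prop⟩
    ⟨fun q => (q.1 0 : ℝ) * (n.toAdd q.2 : ℂ), by fun_prop⟩ fun q => by
      simp only [ContinuousMap.coe_mk, ContinuousMap.HomotopyWith.apply_zero]
      rfl
  -- The homotopy is relative to the boundary, so over boundary points the lift does not change with
  -- time.
  have hb : ∀ y ∈ Cube.boundary (Fin 1), ∀ x, F' (1, (y, x)) = (y 0 : ℝ) * (n.toAdd x : ℂ) := by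
    intro y hy x
    refine (eq_of_unitExp_eq (g := fun t : I => F' (t, (y, x))) (by fun_prop) (c := 1)
      (fun t => ?_) 1 0).trans (hF0 _)
    rw [hF]
    simp only [ContinuousMap.coe_mk]
    rw [F.eq_fst _ hy]
    exact DFunLike.congr_fun ((expLoop n.toAdd).2 y hy) x
  refine toAdd_eq_zero.1 (LocallyConstant.ext fun x => ?_)
  have h1 := hb 1 ⟨0, Or.inr rfl⟩ x
  have h0 := hb 0 ⟨0, Or.inl rfl⟩ x
  have := eq_of_unitExp_eq (g := fun y : Fin 1 → I => F' (1, (y, x))) (by fun_prop) (c := 1)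
      (fun y => by
        rw [hF]
        simp only [ContinuousMap.coe_mk, ContinuousMap.HomotopyWith.apply_one]
        rfl) 1 0
  simp only [h1, h0] at this
  simpa using this

/-- The end value `g (1, x)` of a lift is the winding number `n x`. The lift and the linear function
`y n(x)` agree at both ends of the interval, so the loops are homotopic. -/
theorem expLoopHom_surjective [LocallyCompactSpace X] : Function.Surjective (expLoopHom X) := by
  rintro ⟨a⟩
  obtain ⟨g, hg, hg0⟩ := exists_lift_genLoop one_pos a
  have h1 : a 1 = 1 := a.2 1 ⟨0, Or.inr rfl⟩
  have hz : ∀ x, ∃ n : ℤ, g (1, x) = n := fun x =>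
    unitExp_eq_one_iff.1 (by rw [hg, h1]; rfl)
  choose n hn using hz
  have hnc : Continuous n := by
    refine Complex.isClosedEmbedding_intCast.continuous_iff.2 ?_
    have : ((↑) : ℤ → ℂ) ∘ n = fun x => g (1, x) := funext fun x => (hn x).symm
    rw [this]
    fun_prop
  refine ⟨Multiplicative.ofAdd ⟨n, (IsLocallyConstant.iff_continuous n).2 hnc⟩,
    Quotient.sound ?_⟩
  refine homotopic_of_lifts
    (g := ⟨fun q => (q.1 0 : ℝ) * (n q.2 : ℂ), by fun_prop⟩) (fun y x => rfl) hg ?_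
  rintro y ⟨i, hi⟩ x
  rw [Subsingleton.elim i 0] at hi
  rcases hi with hi | hi
  · have : y = 0 := funext fun j => by rw [Subsingleton.elim j 0, hi]; rfl
    subst this
    simp [hg0]
  · have : y = 1 := funext fun j => by rw [Subsingleton.elim j 0, hi]; rfl
    subst this
    simp [hn]

theorem piHom_precompHom_expLoopHom (f : C(Y, X)) (n : LocallyConstant X ℤ) :
    piHom 0 (precompHom ℂ f) (expLoopHom X (Multiplicative.ofAdd n)) =
      expLoopHom Y (Multiplicative.ofAdd (n.comap f)) := rfl

end FundamentalGroup

/-! ### Čech cohomology as a direct limit -/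

section CechLimit

variable {X Y : Type*} [TopologicalSpace X] [TopologicalSpace Y] {M : Type*} [AddCommGroup M]

instance : Nonempty (PtCover X) :=
  ⟨⟨fun _ => Set.univ, fun _ => isOpen_univ, fun _ => Set.mem_univ _⟩⟩

instance : IsDirectedOrder (PtCover X) :=
  ⟨fun U V => ⟨⟨fun x => U.set x ∩ V.set x, fun x => (U.isOpen x).inter (V.isOpen x),
    fun x => ⟨U.mem x, V.mem x⟩⟩, fun _ => Set.inter_subset_left, fun _ => Set.inter_subset_right⟩⟩

open Classical in
/-- The class in `Ȟ^p(X; M)` of a cocycle on the nerve of `U`. -/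
def cechClass (U : PtCover X) {p : ℕ} (c : cocycles U p M) : Cech X p M :=
  AddCommGroup.DirectLimit.of (fun U : PtCover X => NerveCohomology U p M)
    (fun _ _ h => nerveMap id h p M) U (QuotientAddGroup.mk c)

/-- Covers have common refinements, so a class in the limit is represented on a single cover. -/
theorem exists_cechClass_eq {p : ℕ} (z : Cech X p M) :
    ∃ (U : PtCover X) (c : cocycles U p M), cechClass U c = z := by
  classical
  refine AddCommGroup.DirectLimit.induction_on
    (G := fun U : PtCover X => NerveCohomology U p M) (f := fun _ _ h => nerveMap id h p M)
    (C := fun z => ∃ (U : PtCover X) (c : cocycles U p M), cechClass U c = z) z ?_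
  intro U x
  obtain ⟨c, rfl⟩ := QuotientAddGroup.mk_surjective x
  exact ⟨U, c, rfl⟩

theorem cechClass_refine {U V : PtCover X} (h : U ≤ V) {p : ℕ} (c : cocycles U p M) :
    cechClass V (cocycleMap id h p M c) = cechClass U c := by
  classical
  exact AddCommGroup.DirectLimit.of_f (G := fun U : PtCover X => NerveCohomology U p M)
    (f := fun _ _ h => nerveMap id h p M) h (QuotientAddGroup.mk c)

/-- Only this implication is needed: injectivity of the homomorphisms out of Čech cohomology is
proved by exhibiting a coboundary, after refinement if necessary. -/
theorem cechClass_eq_zero {U : PtCover X} {p : ℕ} {c : cocycles U p M}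
    (h : c.1 ∈ boundaries U p M) : cechClass U c = 0 := by
  have : (QuotientAddGroup.mk c : NerveCohomology U p M) = 0 :=
    (QuotientAddGroup.eq_zero_iff _).2 h
  unfold cechClass
  rw [this]
  exact map_zero _

theorem cechMap_cechClass (f : C(Y, X)) {U : PtCover X} {p : ℕ} (c : cocycles U p M) :
    cechMap f p M (cechClass U c) =
      cechClass (U.pullback f) (cocycleMap f (fun _ => subset_rfl) p M c) := by
  classical
  exact AddCommGroup.DirectLimit.lift_of (G := fun U : PtCover X => NerveCohomology U p M)
    (f := fun _ _ h => nerveMap id h p M) _ _ _ U (QuotientAddGroup.mk c)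

open Classical in
/-- The homomorphism on `Ȟ^p(X; M)` given by compatible homomorphisms on cocycles that vanish on
coboundaries. -/
def cechLift {A : Type*} [AddCommGroup A] {p : ℕ} (φ : ∀ U : PtCover X, cocycles U p M →+ A)
    (hb : ∀ U (c : cocycles U p M), c.1 ∈ boundaries U p M → φ U c = 0)
    (hr : ∀ (U V : PtCover X) (h : U ≤ V) (c : cocycles U p M),
      φ V (cocycleMap id h p M c) = φ U c) : Cech X p M →+ A :=
  AddCommGroup.DirectLimit.lift _ _ _
    (fun U => QuotientAddGroup.lift _ (φ U) fun c hc => hb U c hc)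
    fun U V h x => by
      obtain ⟨c, rfl⟩ := QuotientAddGroup.mk_surjective x
      exact hr U V h c

theorem cechLift_cechClass {A : Type*} [AddCommGroup A] {p : ℕ}
    (φ : ∀ U : PtCover X, cocycles U p M →+ A)
    (hb : ∀ U (c : cocycles U p M), c.1 ∈ boundaries U p M → φ U c = 0)
    (hr : ∀ (U V : PtCover X) (h : U ≤ V) (c : cocycles U p M),
      φ V (cocycleMap id h p M c) = φ U c) (U : PtCover X) (c : cocycles U p M) :
    cechLift φ hb hr (cechClass U c) = φ U c := by
  classical
  exact AddCommGroup.DirectLimit.lift_of (G := fun U : PtCover X => NerveCohomology U p M)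
    (f := fun _ _ h => nerveMap id h p M) _ _ _ U (QuotientAddGroup.mk c)

end CechLimit

/-! ### Simplices of low dimension -/

section LowDimension

variable {X : Type*} [TopologicalSpace X] {M : Type*} [AddCommGroup M]

def vertex (U : PtCover X) (x : X) : Simplex U 0 :=
  ⟨fun _ => x, x, Set.mem_iInter.2 fun _ => U.mem x⟩

def edge {U : PtCover X} {x y w : X} (hx : w ∈ U.set x) (hy : w ∈ U.set y) : Simplex U 1 :=
  ⟨![x, y], w, Set.mem_iInter.2 fun i => by fin_cases i <;> assumption⟩

def triangle {U : PtCover X} {x y z w : X} (hx : w ∈ U.set x) (hy : w ∈ U.set y)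
    (hz : w ∈ U.set z) : Simplex U 2 :=
  ⟨![x, y, z], w, Set.mem_iInter.2 fun i => by fin_cases i <;> assumption⟩

theorem eq_vertex {U : PtCover X} (σ : Simplex U 0) : σ = vertex U (σ.1 0) :=
  Subtype.ext (funext fun i => congrArg σ.1 (Fin.fin_one_eq_zero i))

/-- A simplex remembers only its vertices, so an `edge` does not depend on the common point used to
form it. -/
theorem Simplex.ext_one {U : PtCover X} {σ τ : Simplex U 1} (h0 : σ.1 0 = τ.1 0)
    (h1 : σ.1 1 = τ.1 1) : σ = τ :=
  Subtype.ext (funext fun i => by fin_cases i <;> assumption)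

theorem coboundary_zero_apply {U : PtCover X} (b : Cochain U 0 M) (σ : Simplex U 1) :
    coboundary U 0 M b σ = b (vertex U (σ.1 1)) - b (vertex U (σ.1 0)) := by
  change ∑ i : Fin 2, (-1 : ℤ) ^ (i : ℕ) • b (σ.face i) = _
  rw [Fin.sum_univ_two, eq_vertex (σ.face 0), eq_vertex (σ.face 1)]
  simp only [Fin.val_zero, pow_zero, one_smul, Fin.val_one, pow_one, neg_smul, sub_eq_add_neg]
  rfl

theorem coboundary_one_apply {U : PtCover X} (c : Cochain U 1 M) (σ : Simplex U 2) :
    coboundary U 1 M c σ = c (σ.face 0) - c (σ.face 1) + c (σ.face 2) := by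
  change ∑ i : Fin 3, (-1 : ℤ) ^ (i : ℕ) • c (σ.face i) = _
  rw [Fin.sum_univ_three]
  simp [sub_eq_add_neg]

/-- The cocycle condition on the triangle `x, y, z`, solved for its middle face. -/
theorem cocycle_edge {U : PtCover X} (c : cocycles U 1 M) {x y z w : X} (hx : w ∈ U.set x)
    (hy : w ∈ U.set y) (hz : w ∈ U.set z) :
    c.1 (edge hx hz) = c.1 (edge hx hy) + c.1 (edge hy hz) := by
  have h : coboundary U 1 M c.1 (triangle hx hy hz) = 0 := congrFun c.2 _
  rw [coboundary_one_apply] at h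
  have e0 : (triangle hx hy hz).face 0 = edge hy hz := Simplex.ext_one rfl rfl
  have e1 : (triangle hx hy hz).face 1 = edge hx hz := Simplex.ext_one rfl rfl
  have e2 : (triangle hx hy hz).face 2 = edge hx hy := Simplex.ext_one rfl rfl
  rw [e0, e1, e2] at h
  rw [← sub_eq_zero, ← neg_eq_zero, ← h]
  abel

end LowDimension

/-! ### Čech cohomology in degree zero -/

section DegreeZero

variable {X Y : Type*} [TopologicalSpace X] [TopologicalSpace Y]

/-- For `y` in the set attached to `x`, the point `y` lies in both sets, so `x` and `y` span an edge
and the cocycle agrees on them. -/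
theorem isLocallyConstant_cocycle {U : PtCover X} (c : cocycles U 0 ℤ) :
    IsLocallyConstant fun x => c.1 (vertex U x) := by
  refine (IsLocallyConstant.iff_eventually_eq _).2 fun x => ?_
  filter_upwards [(U.isOpen x).mem_nhds (U.mem x)] with y hy
  have h : coboundary U 0 ℤ c.1 (edge hy (U.mem y)) = 0 := congrFun c.2 _
  rw [coboundary_zero_apply, sub_eq_zero] at h
  exact h

/-- A `0`-cocycle is a locally constant function. -/
def zeroCocycleHom (U : PtCover X) : cocycles U 0 ℤ →+ LocallyConstant X ℤ where
  toFun c := ⟨fun x => c.1 (vertex U x), isLocallyConstant_cocycle c⟩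
  map_zero' := rfl
  map_add' _ _ := rfl

variable (X) in
/-- The homomorphism from `Ȟ⁰(X; ℤ)` to the locally constant functions on `X`. -/
def cechZeroHom : Cech X 0 ℤ →+ LocallyConstant X ℤ :=
  cechLift zeroCocycleHom
    (fun U c hc => by
      have h0 : c = 0 := Subtype.ext hc
      rw [h0, map_zero])
    fun _ _ _ _ => rfl

theorem cechZeroHom_cechClass (U : PtCover X) (c : cocycles U 0 ℤ) :
    cechZeroHom X (cechClass U c) = zeroCocycleHom U c := cechLift_cechClass _ _ _ U c

theorem cechZeroHom_injective : Function.Injective (cechZeroHom X) := by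
  rw [injective_iff_map_eq_zero]
  intro z hz
  obtain ⟨U, c, rfl⟩ := exists_cechClass_eq z
  rw [cechZeroHom_cechClass] at hz
  refine cechClass_eq_zero ?_
  change c.1 = 0
  funext σ
  rw [eq_vertex σ]
  exact DFunLike.congr_fun hz (σ.1 0)

theorem cechZeroHom_surjective : Function.Surjective (cechZeroHom X) := by
  intro n
  -- On the cover by level sets of `n`, sets that meet carry the same value, so `n` is a cocycle.
  let U : PtCover X := ⟨fun x => {y | n y = n x}, fun x => n.isLocallyConstant.isOpen_fiber _,
    fun _ => rfl⟩
  have hc : coboundary U 0 ℤ (fun σ => n (σ.1 0)) = 0 := by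
    funext σ
    rw [coboundary_zero_apply]
    obtain ⟨w, hw⟩ := σ.2
    have h0 : n w = n (σ.1 0) := Set.mem_iInter.1 hw 0
    have h1 : n w = n (σ.1 1) := Set.mem_iInter.1 hw 1
    exact sub_eq_zero.2 (h1.symm.trans h0)
  exact ⟨cechClass U ⟨_, hc⟩, cechZeroHom_cechClass U ⟨_, hc⟩⟩

theorem cechZeroHom_cechMap (f : C(Y, X)) (z : Cech X 0 ℤ) :
    cechZeroHom Y (cechMap f 0 ℤ z) = (cechZeroHom X z).comap f := by
  obtain ⟨U, c, rfl⟩ := exists_cechClass_eq z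
  rw [cechMap_cechClass, cechZeroHom_cechClass, cechZeroHom_cechClass]
  rfl

end DegreeZero

/-! ### Čech cohomology in degree one -/

section DegreeOne

variable {X Y : Type*} [TopologicalSpace X] [TopologicalSpace Y]

/-- `c` is the obstruction to patching local logarithms of `f` on the cover `U`. -/
def Represents (U : PtCover X) (c : Cochain U 1 ℤ) (f : C(X, ℂˣ)) : Prop :=
  ∃ l : X → X → ℂ, (∀ x, ContinuousOn (l x) (U.set x)) ∧
    (∀ x, ∀ w ∈ U.set x, unitExp (l x w) = f w) ∧
    ∀ (σ : Simplex U 1) (w : X), w ∈ U.set (σ.1 0) → w ∈ U.set (σ.1 1) →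
      l (σ.1 0) w - l (σ.1 1) w = c σ

theorem Represents.add {U : PtCover X} {c c' : Cochain U 1 ℤ} {f f' : C(X, ℂˣ)}
    (h : Represents U c f) (h' : Represents U c' f') : Represents U (c + c') (f * f') := by
  obtain ⟨l, hl, he, hc⟩ := h
  obtain ⟨l', hl', he', hc'⟩ := h'
  refine ⟨fun x w => l x w + l' x w, fun x => (hl x).add (hl' x), fun x w hw => ?_,
    fun σ w h0 h1 => ?_⟩
  · rw [unitExp_add, he x w hw, he' x w hw]
    rfl
  · rw [add_sub_add_comm, hc σ w h0 h1, hc' σ w h0 h1]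
    simp

theorem Represents.neg {U : PtCover X} {c : Cochain U 1 ℤ} {f : C(X, ℂˣ)}
    (h : Represents U c f) : Represents U (-c) f⁻¹ := by
  obtain ⟨l, hl, he, hc⟩ := h
  refine ⟨fun x w => -l x w, fun x => (hl x).neg, fun x w hw => ?_, fun σ w h0 h1 => ?_⟩
  · rw [unitExp_neg, he x w hw]
    rfl
  · rw [neg_sub_neg, ← neg_sub, hc σ w h0 h1]
    simp

theorem Represents.pullback {U : PtCover X} {V : PtCover Y} {c : Cochain U 1 ℤ} {f : C(X, ℂˣ)}
    (h : Represents U c f) (φ : C(Y, X)) (hφ : Subordinate φ V U) :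
    Represents V (cochainMap φ hφ 1 ℤ c) (f.comp φ) := by
  obtain ⟨l, hl, he, hc⟩ := h
  refine ⟨fun y w => l (φ y) (φ w), fun y => (hl (φ y)).comp φ.continuous.continuousOn (hφ y),
    fun y w hw => he _ _ (hφ y hw), fun σ w h0 h1 => ?_⟩
  exact hc (σ.map φ hφ) (φ w) (hφ _ h0) (hφ _ h1)

/-- If `c` is the coboundary of `b`, the corrected logarithms `l x + b x` agree on overlaps and
patch to a global logarithm, and the integers `b x` do not affect the exponential. -/
theorem Represents.joined_of_boundary {U : PtCover X} {c : Cochain U 1 ℤ} {f : C(X, ℂˣ)}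
    (h : Represents U c f) (hb : c ∈ boundaries U 1 ℤ) : Joined 1 f := by
  obtain ⟨l, hl, he, hc⟩ := h
  obtain ⟨b, rfl⟩ := hb
  -- The global logarithm is defined on the diagonal, using at `w` the set attached to `w`; near `x`
  -- it equals the continuous function `l x + b x`.
  have key : ∀ x, ∀ w ∈ U.set x, l w w + b (vertex U w) = l x w + b (vertex U x) := by
    intro x w hw
    have := hc (edge hw (U.mem w)) w hw (U.mem w)
    rw [coboundary_zero_apply] at this
    change l x w - l w w = ((b (vertex U w) - b (vertex U x) : ℤ) : ℂ) at this
    push_cast at this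
    linear_combination -this
  refine joined_of_eq_unitExp (g := fun w => l w w + b (vertex U w)) ?_ fun w => ?_
  · rw [continuous_iff_continuousAt]
    intro x
    have hU := (U.isOpen x).mem_nhds (U.mem x)
    refine (((hl x).continuousAt hU).add (continuousAt_const (y := (b (vertex U x) : ℂ)))).congr ?_
    filter_upwards [hU] with w hw
    exact (key x w hw).symm
  · rw [unitExp_add, unitExp_intCast, he w w (U.mem w)]
    simp

/-- With a global logarithm `g` available, each `l x - g` is continuous and integer valued on the
set of `x`. On a smaller neighbourhood of `x` it is constant, and these constants bound the cocycle.
-/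
theorem Represents.exists_boundary [LocallyCompactSpace X] {U : PtCover X} {c : Cochain U 1 ℤ}
    {f : C(X, ℂˣ)} (h : Represents U c f) (hf : Joined 1 f) :
    ∃ (V : PtCover X) (hV : U ≤ V), cochainMap id hV 1 ℤ c ∈ boundaries V 1 ℤ := by
  obtain ⟨l, hl, he, hc⟩ := h
  obtain ⟨g, hg⟩ := exists_eq_unitExp_of_joined hf
  have hz : ∀ x w, ∃ n : ℤ, w ∈ U.set x → l x w - g w = n := by
    intro x w
    by_cases hw : w ∈ U.set x
    · obtain ⟨n, hn⟩ := unitExp_eq_iff.1 ((he x w hw).trans (hg w))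
      exact ⟨n, fun _ => hn⟩
    · exact ⟨0, fun h => absurd h hw⟩
  choose n hn using hz
  -- Radius `1` suffices: integers at distance less than `1` are equal.
  let V : PtCover X := ⟨fun x => U.set x ∩ (fun w => l x w - g w) ⁻¹' Metric.ball (n x x : ℂ) 1,
    fun x => ((hl x).sub g.continuous.continuousOn).isOpen_inter_preimage (U.isOpen x)
      Metric.isOpen_ball,
    fun x => ⟨U.mem x, by
      change l x x - g x ∈ Metric.ball (n x x : ℂ) 1
      rw [hn x x (U.mem x)]
      exact Metric.mem_ball_self one_pos⟩⟩
  have hV : ∀ x, ∀ w ∈ V.set x, l x w - g w = n x x := by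
    rintro x w ⟨hw, hb⟩
    change l x w - g w ∈ Metric.ball (n x x : ℂ) 1 at hb
    rw [hn x w hw] at hb ⊢
    rw [Metric.mem_ball, Complex.dist_eq, ← Int.cast_sub, Complex.norm_intCast] at hb
    have : |n x w - n x x| < 1 := by exact_mod_cast hb
    rw [sub_eq_zero.1 (Int.abs_lt_one_iff.1 this)]
  -- The sign matches the coboundary, which is the value at vertex `1` minus the value at vertex
  -- `0`, whereas `c` is `l` at vertex `0` minus `l` at vertex `1`.
  refine ⟨V, fun x => Set.inter_subset_left, fun σ => -n (σ.1 0) (σ.1 0), ?_⟩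
  funext σ
  rw [coboundary_zero_apply]
  obtain ⟨w, hw⟩ := σ.2
  have h0 : w ∈ V.set (σ.1 0) := Set.mem_iInter.1 hw 0
  have h1 : w ∈ V.set (σ.1 1) := Set.mem_iInter.1 hw 1
  have hcσ := hc (σ.map id fun x => Set.inter_subset_left) w h0.1 h1.1
  change l (σ.1 0) w - l (σ.1 1) w = ((cochainMap id _ 1 ℤ c σ : ℤ) : ℂ) at hcσ
  have e0 := hV _ w h0
  have e1 := hV _ w h1
  change -n (σ.1 1) (σ.1 1) - -n (σ.1 0) (σ.1 0) = _
  have : ((n (σ.1 0) (σ.1 0) - n (σ.1 1) (σ.1 1) : ℤ) : ℂ) =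
      ((cochainMap id (fun x => Set.inter_subset_left) 1 ℤ c σ : ℤ) : ℂ) := by
    rw [← hcσ]
    push_cast
    rw [← e0, ← e1]
    ring
  have := Int.cast_injective this
  rw [← this]
  ring

open Classical in
/-- Every cocycle represents a function, by a partition of unity. -/
theorem exists_represents [NormalSpace X] [ParacompactSpace X] {U : PtCover X}
    (c : cocycles U 1 ℤ) : ∃ f, Represents U c.1 f := by
  obtain ⟨φ, hφ⟩ := PartitionOfUnity.exists_isSubordinate isClosed_univ U.set U.isOpen
    fun x _ => Set.mem_iUnion.2 ⟨x, U.mem x⟩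
  -- The cocycle extended by `0` to pairs of disjoint sets; those values are multiplied by zero
  -- wherever they could matter.
  let v : X → X → ℂ := fun x y =>
    if h : ∃ w, w ∈ U.set x ∧ w ∈ U.set y then (c.1 (edge h.choose_spec.1 h.choose_spec.2) : ℂ)
    else 0
  have hv : ∀ {x y w : X} (hx : w ∈ U.set x) (hy : w ∈ U.set y), v x y = c.1 (edge hx hy) :=
    fun {x y w} hx hy => dif_pos (⟨w, hx, hy⟩ : ∃ w, w ∈ U.set x ∧ w ∈ U.set y)
  -- Averaging the cocycle in its second index makes it a coboundary of continuous functions: by the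
  -- cocycle condition, `l x - l x'` is `c(x, x')` times the sum of the partition.
  let l : X → X → ℂ := fun x w => ∑ᶠ y, φ y w • v x y
  have hl : ∀ x, Continuous (l x) := fun x =>
    φ.continuous_finsum_smul (g := fun y _ => v x y) fun _ _ _ => continuousAt_const
  have hfin : ∀ x w, (Function.support fun y => φ y w • v x y).Finite := fun x w =>
    (φ.locallyFinite.point_finite w).subset fun y hy h => hy (by
      have h' : φ y w = 0 := h
      simp only [h', zero_smul])
  have hd : ∀ {x x' w : X} (hx : w ∈ U.set x) (hx' : w ∈ U.set x'),
      l x w - l x' w = c.1 (edge hx hx') := by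
    intro x x' w hx hx'
    have h1 : ∀ y, φ y w • v x y - φ y w • v x' y = φ y w • (c.1 (edge hx hx') : ℂ) := by
      intro y
      by_cases hy : φ y w = 0
      · simp [hy]
      · have hyU : w ∈ U.set y := hφ y (subset_tsupport _ hy)
        rw [← smul_sub, hv hx hyU, hv hx' hyU, cocycle_edge c hx hx' hyU]
        push_cast
        rw [add_sub_cancel_right]
    rw [← finsum_sub_distrib (hfin x w) (hfin x' w), finsum_congr h1, ← finsum_smul,
      φ.sum_eq_one (Set.mem_univ w), one_smul]
  -- The differences are integers, so the exponentials patch to one function on `X`.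
  have he : ∀ x, ∀ w ∈ U.set x, unitExp (l x w) = unitExp (l w w) := fun x w hw =>
    unitExp_eq_iff.2 ⟨_, hd hw (U.mem w)⟩
  refine ⟨⟨fun w => unitExp (l w w), ?_⟩, l, fun x => (hl x).continuousOn, he,
    fun σ w h0 h1 => ?_⟩
  · rw [continuous_iff_continuousAt]
    intro x
    have hU := (U.isOpen x).mem_nhds (U.mem x)
    refine (continuous_unitExp.comp (hl x)).continuousAt.congr ?_
    filter_upwards [hU] with w hw
    exact he x w hw
  · rw [hd h0 h1, Simplex.ext_one (σ := edge h0 h1) (τ := σ) rfl rfl]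

/-- A branch of the logarithm inverse to `unitExp`. -/
def unitLog (w : ℂˣ) : ℂ := Complex.log w / (2 * Real.pi * Complex.I)

theorem unitExp_unitLog (w : ℂˣ) : unitExp (unitLog w) = w := by
  ext
  rw [val_unitExp, unitLog, mul_div_cancel₀ _ Complex.two_pi_I_ne_zero, Complex.exp_log w.ne_zero]

theorem unitLog_one : unitLog 1 = 0 := by simp [unitLog]

theorem continuousOn_unitLog : ContinuousOn unitLog {w | (w : ℂ) ∈ Complex.slitPlane} :=
  (Units.continuous_val.continuousOn.clog fun _ h => h).div_const _

/-- Every nowhere vanishing function comes from a cocycle on some cover. -/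
theorem exists_cocycle_represents (f : C(X, ℂˣ)) :
    ∃ (U : PtCover X) (c : cocycles U 1 ℤ), Represents U c.1 f := by
  -- A neighbourhood of `1` on which the logarithm is continuous and smaller than `1/4`. Four such
  -- errors add up to less than `1`, which is what `hconst` needs.
  let S : Set ℂˣ := {w | (w : ℂ) ∈ Complex.slitPlane} ∩ unitLog ⁻¹' Metric.ball 0 (1 / 4)
  have hS : IsOpen S := continuousOn_unitLog.isOpen_inter_preimage
    (Complex.isOpen_slitPlane.preimage Units.continuous_val) Metric.isOpen_ball
  have h1S : (1 : ℂˣ) ∈ S := ⟨by simp, by simp [unitLog_one]⟩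
  have hfc : ∀ x, Continuous fun w => f w / f x := fun x => by fun_prop
  let U : PtCover X := ⟨fun x => {w | f w / f x ∈ S}, fun x => hS.preimage (hfc x),
    fun x => by
      change f x / f x ∈ S
      rwa [div_self']⟩
  -- A logarithm of `f` centred at `x`: the branch cut is avoided because `f w / f x` is close to
  -- `1`.
  let l : X → X → ℂ := fun x w => unitLog (f x) + unitLog (f w / f x)
  have hl : ∀ x, ContinuousOn (l x) (U.set x) := fun x =>
    continuousOn_const.add (continuousOn_unitLog.comp (hfc x).continuousOn fun w hw => hw.1)
  have he : ∀ x w, unitExp (l x w) = f w := fun x w => by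
    rw [unitExp_add, unitExp_unitLog, unitExp_unitLog, mul_div_cancel]
  have hz : ∀ x y w, ∃ n : ℤ, l x w - l y w = n := fun x y w =>
    unitExp_eq_iff.1 ((he x w).trans (he y w).symm)
  choose n hn using hz
  have hclose : ∀ {x y w}, w ∈ U.set x → w ∈ U.set y →
      ‖(n x y w : ℂ) - (unitLog (f x) - unitLog (f y))‖ < 1 / 4 + 1 / 4 := by
    intro x y w hx hy
    have h1 : ‖unitLog (f w / f x)‖ < 1 / 4 := by simpa using hx.2
    have h2 : ‖unitLog (f w / f y)‖ < 1 / 4 := by simpa using hy.2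
    have : (n x y w : ℂ) - (unitLog (f x) - unitLog (f y)) =
        unitLog (f w / f x) - unitLog (f w / f y) := by
      rw [← hn]
      ring
    rw [this]
    exact (norm_sub_le _ _).trans_lt (add_lt_add h1 h2)
  -- Overlaps need not be connected, so constancy comes from size: every `n x y w` lies within `1/2`
  -- of a number independent of `w`.
  have hconst : ∀ {x y w w'}, w ∈ U.set x → w ∈ U.set y → w' ∈ U.set x → w' ∈ U.set y →
      n x y w = n x y w' := by
    intro x y w w' hx hy hx' hy'
    have h : ‖((n x y w - n x y w' : ℤ) : ℂ)‖ < 1 := by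
      have h1 := (norm_sub_le _ _).trans_lt (add_lt_add (hclose hx hy) (hclose hx' hy'))
      rw [sub_sub_sub_cancel_right, ← Int.cast_sub] at h1
      exact h1.trans_le (by norm_num)
    rw [Complex.norm_intCast] at h
    have : |n x y w - n x y w'| < 1 := by exact_mod_cast h
    exact sub_eq_zero.1 (Int.abs_lt_one_iff.1 this)
  let c : Cochain U 1 ℤ := fun σ => n (σ.1 0) (σ.1 1) σ.2.choose
  have hc : ∀ (σ : Simplex U 1) {w : X}, w ∈ U.set (σ.1 0) → w ∈ U.set (σ.1 1) →
      (c σ : ℂ) = l (σ.1 0) w - l (σ.1 1) w := by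
    intro σ w h0 h1
    rw [hn]
    exact congrArg _ (hconst (Set.mem_iInter.1 σ.2.choose_spec 0)
      (Set.mem_iInter.1 σ.2.choose_spec 1) h0 h1)
  refine ⟨U, ⟨c, ?_⟩, l, hl, fun x w _ => he x w, fun σ w h0 h1 => (hc σ h0 h1).symm⟩
  change coboundary U 1 ℤ c = 0
  funext σ
  rw [coboundary_one_apply]
  obtain ⟨w, hw⟩ := σ.2
  rw [Set.mem_iInter] at hw
  have e0 := hc (σ.face 0) (w := w) (hw _) (hw _)
  have e1 := hc (σ.face 1) (w := w) (hw _) (hw _)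
  have e2 := hc (σ.face 2) (w := w) (hw _) (hw _)
  change (c (σ.face 0) : ℂ) = l (σ.1 1) w - l (σ.1 2) w at e0
  change (c (σ.face 1) : ℂ) = l (σ.1 0) w - l (σ.1 2) w at e1
  change (c (σ.face 2) : ℂ) = l (σ.1 0) w - l (σ.1 1) w at e2
  have : ((c (σ.face 0) - c (σ.face 1) + c (σ.face 2) : ℤ) : ℂ) = 0 := by
    push_cast
    rw [e0, e1, e2]
    ring
  exact_mod_cast this

/-- `π₀` of a commutative topological group is commutative. -/
abbrev zerothHomotopyCommGroup {H : Type*} [CommGroup H] [TopologicalSpace H]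
    [IsTopologicalGroup H] : CommGroup (ZerothHomotopy H) where
  __ := (inferInstance : Group (ZerothHomotopy H))
  mul_comm := by
    rintro ⟨a⟩ ⟨b⟩
    exact congrArg ZerothHomotopy.mk (mul_comm a b)

attribute [local instance] zerothHomotopyCommGroup

/-- The quotient of the two functions is represented by `c - c'`, hence lies in the component of
`1`. -/
theorem Represents.mk_eq {U : PtCover X} {c c' : Cochain U 1 ℤ} {f f' : C(X, ℂˣ)}
    (h : Represents U c f) (h' : Represents U c' f') (hc : c - c' ∈ boundaries U 1 ℤ) :
    ZerothHomotopy.mk f = ZerothHomotopy.mk f' := by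
  have h1 := h.add h'.neg
  rw [← sub_eq_add_neg] at h1
  have h2 : (1 : ZerothHomotopy C(X, ℂˣ)) = ZerothHomotopy.mk f * (ZerothHomotopy.mk f')⁻¹ :=
    Quotient.sound (h1.joined_of_boundary hc)
  rw [eq_comm, mul_inv_eq_one] at h2
  exact h2

section

variable [NormalSpace X] [ParacompactSpace X] [NormalSpace Y] [ParacompactSpace Y]

/-- The component of `C(X, ℂˣ)` given by a `1`-cocycle. -/
def oneCocycleHom (U : PtCover X) : cocycles U 1 ℤ →+ Additive (ZerothHomotopy C(X, ℂˣ)) :=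
  AddMonoidHom.mk' (fun c => Additive.ofMul (ZerothHomotopy.mk (exists_represents c).choose))
    fun c c' => by
      refine congrArg Additive.ofMul
        ((exists_represents (c + c')).choose_spec.mk_eq
          ((exists_represents c).choose_spec.add (exists_represents c').choose_spec) ?_)
      have : (c + c').1 - (c.1 + c'.1) = 0 := sub_self _
      rw [this]
      exact zero_mem _

/-- The component does not depend on the chosen representing function; every later computation goes
through this. -/
theorem Represents.oneCocycleHom_eq {U : PtCover X} {c : cocycles U 1 ℤ} {f : C(X, ℂˣ)}
    (h : Represents U c.1 f) : oneCocycleHom U c = Additive.ofMul (ZerothHomotopy.mk f) :=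
  congrArg Additive.ofMul ((exists_represents c).choose_spec.mk_eq h (by
    rw [sub_self]
    exact zero_mem _))

variable (X) in
/-- The homomorphism `Ȟ¹(X; ℤ) → π₀ C(X, ℂˣ)`. -/
def cechOneHom : Cech X 1 ℤ →+ Additive (ZerothHomotopy C(X, ℂˣ)) :=
  cechLift oneCocycleHom
    (fun U c hc => by
      obtain ⟨f, hf⟩ := exists_represents c
      rw [hf.oneCocycleHom_eq]
      exact congrArg Additive.ofMul (Quotient.sound (hf.joined_of_boundary hc).symm))
    fun U V h c => by
      obtain ⟨f, hf⟩ := exists_represents c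
      have hf' : Represents V (cocycleMap id h 1 ℤ c).1 f := hf.pullback (ContinuousMap.id X) h
      rw [hf.oneCocycleHom_eq, hf'.oneCocycleHom_eq]

theorem Represents.cechOneHom_cechClass {U : PtCover X} {c : cocycles U 1 ℤ} {f : C(X, ℂˣ)}
    (h : Represents U c.1 f) :
    cechOneHom X (cechClass U c) = Additive.ofMul (ZerothHomotopy.mk f) :=
  (cechLift_cechClass _ _ _ U c).trans h.oneCocycleHom_eq

/-- A representing function in the component of `1` has a global logarithm, which makes the cocycle
a coboundary on a finer cover. -/
theorem cechOneHom_injective [LocallyCompactSpace X] : Function.Injective (cechOneHom X) := by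
  rw [injective_iff_map_eq_zero]
  intro z hz
  obtain ⟨U, c, rfl⟩ := exists_cechClass_eq z
  obtain ⟨f, hf⟩ := exists_represents c
  rw [hf.cechOneHom_cechClass] at hz
  have hj : Joined f 1 := Quotient.exact (Additive.ofMul.injective hz)
  obtain ⟨V, hV, hb⟩ := hf.exists_boundary hj.symm
  rw [← cechClass_refine hV]
  exact cechClass_eq_zero hb

theorem cechOneHom_surjective : Function.Surjective (cechOneHom X) := by
  intro z
  obtain ⟨⟨f⟩, rfl⟩ := Additive.ofMul.surjective z
  obtain ⟨U, c, hc⟩ := exists_cocycle_represents f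
  exact ⟨_, hc.cechOneHom_cechClass⟩

theorem cechOneHom_cechMap (f : C(Y, X)) (z : Cech X 1 ℤ) :
    (cechOneHom Y (cechMap f 1 ℤ z)).toMul =
      pi0Hom (precompHom ℂ f) (cechOneHom X z).toMul := by
  obtain ⟨U, c, rfl⟩ := exists_cechClass_eq z
  obtain ⟨g, hg⟩ := exists_represents c
  have hg' : Represents (U.pullback f) (cocycleMap f (fun _ => subset_rfl) 1 ℤ c).1 (g.comp f) :=
    hg.pullback f _
  rw [cechMap_cechClass, hg.cechOneHom_cechClass, hg'.cechOneHom_cechClass]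
  rfl

end

end DegreeOne

/-! ### The homotopy of `C(X, ℂˣ)` and Čech cohomology -/

section Theta

variable (X : Type*) [TopologicalSpace X] [LocallyCompactSpace X]

/-- `Ȟ⁰(X; ℤ) ≅ π₁ C(X, ℂˣ)`. -/
def cechZeroEquiv : Multiplicative (Cech X 0 ℤ) ≃* π_ 1 C(X, ℂˣ) 1 :=
  MulEquiv.ofBijective ((expLoopHom X).comp (AddMonoidHom.toMultiplicative (cechZeroHom X)))
    ⟨expLoopHom_injective.comp cechZeroHom_injective,
      expLoopHom_surjective.comp cechZeroHom_surjective⟩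

variable [NormalSpace X] [ParacompactSpace X]

/-- `Ȟ¹(X; ℤ) ≅ π₀ C(X, ℂˣ)`. -/
def cechOneEquiv : Multiplicative (Cech X 1 ℤ) ≃* ZerothHomotopy C(X, ℂˣ) :=
  MulEquiv.ofBijective
    (MonoidHom.mk' (fun z => (cechOneHom X z.toAdd).toMul) fun a b =>
      congrArg Additive.toMul (map_add (cechOneHom X) a.toAdd b.toAdd))
    ⟨cechOneHom_injective, cechOneHom_surjective⟩

end Theta

section ThetaNatural

variable {X Y : Type*} [TopologicalSpace X] [LocallyCompactSpace X] [TopologicalSpace Y]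
  [LocallyCompactSpace Y]

/-- If an isomorphism is natural, so is its inverse. -/
theorem symm_comp_eq {A A' C C' : Type*} [Group A] [Group A'] [Group C] [Group C'] {θ : A ≃* C}
    {θ' : A' ≃* C'} {f : A →* A'} {g : C →* C'}
    (h : ∀ x, θ' (f x) = g (θ x)) :
    θ'.symm.toMonoidHom.comp g = f.comp θ.symm.toMonoidHom := by
  ext x
  obtain ⟨y, rfl⟩ := θ.surjective x
  change θ'.symm (g (θ y)) = f (θ.symm (θ y))
  rw [← h, θ'.symm_apply_apply, θ.symm_apply_apply]

theorem cechZeroEquiv_cechMul (f : C(Y, X)) (z : Multiplicative (Cech X 0 ℤ)) :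
    cechZeroEquiv Y (cechMul f 0 z) = piHom 0 (precompHom ℂ f) (cechZeroEquiv X z) := by
  change expLoopHom Y (Multiplicative.ofAdd (cechZeroHom Y (cechMap f 0 ℤ z.toAdd))) = _
  rw [cechZeroHom_cechMap, ← piHom_precompHom_expLoopHom]
  rfl

theorem cechOneEquiv_cechMul [NormalSpace X] [ParacompactSpace X] [NormalSpace Y]
    [ParacompactSpace Y] (f : C(Y, X)) (z : Multiplicative (Cech X 1 ℤ)) :
    cechOneEquiv Y (cechMul f 1 z) = pi0Hom (precompHom ℂ f) (cechOneEquiv X z) :=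
  cechOneHom_cechMap f z.toAdd

theorem cechZeroEquiv_natural (f : C(Y, X)) :
    (cechZeroEquiv Y).symm.toMonoidHom.comp (piHom 0 (precompHom ℂ f)) =
      (cechMul f 0).comp (cechZeroEquiv X).symm.toMonoidHom :=
  symm_comp_eq (cechZeroEquiv_cechMul f)

theorem cechOneEquiv_natural [NormalSpace X] [ParacompactSpace X] [NormalSpace Y]
    [ParacompactSpace Y] (f : C(Y, X)) :
    (cechOneEquiv Y).symm.toMonoidHom.comp (pi0Hom (precompHom ℂ f)) =
      (cechMul f 1).comp (cechOneEquiv X).symm.toMonoidHom :=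
  symm_comp_eq (cechOneEquiv_cechMul f)

end ThetaNatural

/-! ### Naturality of the exact sequences -/

section SequenceNatural

variable {G P X P' X' : Type*} [Group G] [TopologicalSpace G] [IsTopologicalGroup G]
  [TopologicalSpace P] [TopologicalSpace X] [MulAction G P] [ContinuousSMul G P]
  [TopologicalSpace P'] [TopologicalSpace X'] [MulAction G P'] [ContinuousSMul G P']
  [LocallyCompactSpace X] [LocallyCompactSpace X']
  {ζ : PrincipalBundle G P X} {ζ' : PrincipalBundle G P' X'}
  {B B' : Type*} [NonUnitalRing B] [TopologicalSpace B] [IsTopologicalRing B]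
  [DistribMulAction G B] [ContinuousSMul G B] [MulAct G B]
  [NonUnitalRing B'] [TopologicalSpace B'] [IsTopologicalRing B']
  [DistribMulAction G B'] [ContinuousSMul G B'] [MulAct G B']

theorem piHom_idComponentMap_glIncl_natural {𝕜 : Type*} [CommRing 𝕜] [TopologicalSpace 𝕜]
    [IsTopologicalRing 𝕜] [Module 𝕜 B] [IsScalarTower 𝕜 B B] [SMulCommClass 𝕜 B B]
    [ContinuousSMul 𝕜 B] [SMulCommClass G 𝕜 B] [Module 𝕜 B'] [IsScalarTower 𝕜 B' B']
    [SMulCommClass 𝕜 B' B'] [ContinuousSMul 𝕜 B'] [SMulCommClass G 𝕜 B'] (k : ℕ)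
    (m : BundleMap ζ' ζ) (α : EquivariantHom 𝕜 G B B') :
    (piHom k (idComponentMap (glIncl 𝕜 ζ' B'))).comp (piHom k (idComponentMap (glMap m α))) =
      (piHom k (idComponentMap (glPlusMap m α))).comp
        (piHom k (idComponentMap (glIncl 𝕜 ζ B))) := by
  rw [piHom_comp, piHom_comp, idComponentMap_comp, idComponentMap_comp, glIncl_comp_glMap]

variable [Module ℂ B] [IsScalarTower ℂ B B] [SMulCommClass ℂ B B]
  [ContinuousSMul ℂ B] [SMulCommClass G ℂ B] [Module ℂ B'] [IsScalarTower ℂ B' B']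
  [SMulCommClass ℂ B' B'] [ContinuousSMul ℂ B'] [SMulCommClass G ℂ B']
  (m : BundleMap ζ' ζ) (α : EquivariantHom ℂ G B B')

section

variable {θ : ZerothHomotopy C(X, ℂˣ) ≃* Multiplicative (Cech X 1 ℤ)}
  {θ' : ZerothHomotopy C(X', ℂˣ) ≃* Multiplicative (Cech X' 1 ℤ)}

theorem quot0_natural (hθ : θ'.toMonoidHom.comp (pi0Hom (precompHom ℂ m.base)) =
      (cechMul m.base 1).comp θ.toMonoidHom) :
    (quot0 ζ' B' θ').comp (pi0Hom (glPlusMap m α)) =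
      (cechMul m.base 1).comp (quot0 ζ B θ) := by
  unfold quot0
  rw [MonoidHom.comp_assoc, pi0Hom_comp, glProj_comp_glPlusMap, ← pi0Hom_comp,
    ← MonoidHom.comp_assoc, hθ, MonoidHom.comp_assoc]

theorem split0_natural (hθ : θ'.toMonoidHom.comp (pi0Hom (precompHom ℂ m.base)) =
      (cechMul m.base 1).comp θ.toMonoidHom) :
    (split0 ζ' B' θ').comp (cechMul m.base 1) =
      (pi0Hom (glPlusMap m α)).comp (split0 ζ B θ) := by
  unfold split0
  rw [MonoidHom.comp_assoc, symm_comp_eq (DFunLike.congr_fun hθ), ← MonoidHom.comp_assoc,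
    pi0Hom_comp, glScalar_comp_precompHom m α, ← pi0Hom_comp, MonoidHom.comp_assoc]

end

section

variable {θ : π_ 1 C(X, ℂˣ) 1 ≃* Multiplicative (Cech X 0 ℤ)}
  {θ' : π_ 1 C(X', ℂˣ) 1 ≃* Multiplicative (Cech X' 0 ℤ)}

theorem quot1_natural (hθ : θ'.toMonoidHom.comp (piHom 0 (precompHom ℂ m.base)) =
      (cechMul m.base 0).comp θ.toMonoidHom) :
    (quot1 ζ' B' θ').comp (piHom 0 (glPlusMap m α)) =
      (cechMul m.base 0).comp (quot1 ζ B θ) := by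
  unfold quot1
  rw [MonoidHom.comp_assoc, piHom_comp, glProj_comp_glPlusMap, ← piHom_comp,
    ← MonoidHom.comp_assoc, hθ, MonoidHom.comp_assoc]

theorem split1_natural (hθ : θ'.toMonoidHom.comp (piHom 0 (precompHom ℂ m.base)) =
      (cechMul m.base 0).comp θ.toMonoidHom) :
    (split1 ζ' B' θ').comp (cechMul m.base 0) =
      (piHom 0 (glPlusMap m α)).comp (split1 ζ B θ) := by
  unfold split1
  rw [MonoidHom.comp_assoc, symm_comp_eq (DFunLike.congr_fun hθ), ← MonoidHom.comp_assoc,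
    piHom_comp, glScalar_comp_precompHom m α, ← piHom_comp, MonoidHom.comp_assoc]

end

end SequenceNatural

end SectionGL

end

/-! ### The main theorem: the splitting combined with the homotopy of `C(X, 𝔽ˣ)`. -/

theorem mainTheorem8 :
    -- complex case, `j = 0, 1`
    (∃ (θ₀ : ∀ (X : Type u) [MetricSpace X] [CompactSpace X],
          ZerothHomotopy C(X, ℂˣ) ≃* Multiplicative (Cech X 1 ℤ))
        (θ₁ : ∀ (X : Type u) [MetricSpace X] [CompactSpace X],
          π_ 1 C(X, ℂˣ) 1 ≃* Multiplicative (Cech X 0 ℤ)),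
      -- the identifications of the homotopy of `C(X, ℂ - 0)` are natural in `X`
      (∀ (X Y : Type u) [MetricSpace X] [CompactSpace X] [MetricSpace Y] [CompactSpace Y]
        (f : C(Y, X)),
        (θ₀ Y).toMonoidHom.comp (pi0Hom (precompHom ℂ f)) =
          (cechMul f 1).comp (θ₀ X).toMonoidHom ∧
        (θ₁ Y).toMonoidHom.comp (piHom 0 (precompHom ℂ f)) =
          (cechMul f 0).comp (θ₁ X).toMonoidHom) ∧
      -- the split short exact sequences
      (∀ (G : Type w) [Group G] [TopologicalSpace G] [IsTopologicalGroup G]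
      (X : Type u) [MetricSpace X] [CompactSpace X]
      (P : Type v) [TopologicalSpace P] [MulAction G P] [ContinuousSMul G P]
      (ζ : PrincipalBundle G P X)
      (B : Type z) [NonUnitalNormedRing B] [NormedSpace ℂ B] [IsScalarTower ℂ B B]
      [SMulCommClass ℂ B B] [CompleteSpace B]
      [DistribMulAction G B] [ContinuousSMul G B] [MulAct G B] [SMulCommClass G ℂ B],
        IsSplitShortExact (pi0Hom (glIncl ℂ ζ B)) (quot0 ζ B (θ₀ X)) (split0 ζ B (θ₀ X)) ∧
        IsSplitShortExact (piHom 0 (glIncl ℂ ζ B)) (quot1 ζ B (θ₁ X)) (split1 ζ B (θ₁ X))) ∧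
      -- their naturality
      (∀ (G : Type w) [Group G] [TopologicalSpace G] [IsTopologicalGroup G]
      (X : Type u) [MetricSpace X] [CompactSpace X]
      (P : Type v) [TopologicalSpace P] [MulAction G P] [ContinuousSMul G P]
      (ζ : PrincipalBundle G P X)
      (B : Type z) [NonUnitalNormedRing B] [NormedSpace ℂ B] [IsScalarTower ℂ B B]
      [SMulCommClass ℂ B B] [CompleteSpace B]
      [DistribMulAction G B] [ContinuousSMul G B] [MulAct G B] [SMulCommClass G ℂ B]
      (X' : Type u) [MetricSpace X'] [CompactSpace X']
      (P' : Type v) [TopologicalSpace P'] [MulAction G P'] [ContinuousSMul G P']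
      (ζ' : PrincipalBundle G P' X')
      (B' : Type z) [NonUnitalNormedRing B'] [NormedSpace ℂ B'] [IsScalarTower ℂ B' B']
      [SMulCommClass ℂ B' B'] [CompleteSpace B']
      [DistribMulAction G B'] [ContinuousSMul G B'] [MulAct G B'] [SMulCommClass G ℂ B']
      (m : BundleMap ζ' ζ) (α : EquivariantHom ℂ G B B'),
        ((pi0Hom (glIncl ℂ ζ' B')).comp (pi0Hom (glMap m α)) =
            (pi0Hom (glPlusMap m α)).comp (pi0Hom (glIncl ℂ ζ B)) ∧
          (quot0 ζ' B' (θ₀ X')).comp (pi0Hom (glPlusMap m α)) =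
            (cechMul m.base 1).comp (quot0 ζ B (θ₀ X)) ∧
          (split0 ζ' B' (θ₀ X')).comp (cechMul m.base 1) =
            (pi0Hom (glPlusMap m α)).comp (split0 ζ B (θ₀ X))) ∧
        ((piHom 0 (glIncl ℂ ζ' B')).comp (piHom 0 (glMap m α)) =
            (piHom 0 (glPlusMap m α)).comp (piHom 0 (glIncl ℂ ζ B)) ∧
          (quot1 ζ' B' (θ₁ X')).comp (piHom 0 (glPlusMap m α)) =
            (cechMul m.base 0).comp (quot1 ζ B (θ₁ X)) ∧
          (split1 ζ' B' (θ₁ X')).comp (cechMul m.base 0) =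
            (piHom 0 (glPlusMap m α)).comp (split1 ζ B (θ₁ X))))) ∧
    -- complex case, `j = k + 1 ≥ 2`: natural isomorphisms of homotopy groups
    (∀ (k : ℕ), 2 ≤ k + 1 →
      (∀ (G : Type w) [Group G] [TopologicalSpace G] [IsTopologicalGroup G]
      (X : Type u) [MetricSpace X] [CompactSpace X]
      (P : Type v) [TopologicalSpace P] [MulAction G P] [ContinuousSMul G P]
      (ζ : PrincipalBundle G P X)
      (B : Type z) [NonUnitalNormedRing B] [NormedSpace ℂ B] [IsScalarTower ℂ B B]
      [SMulCommClass ℂ B B] [CompleteSpace B]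
      [DistribMulAction G B] [ContinuousSMul G B] [MulAct G B] [SMulCommClass G ℂ B],
        Function.Bijective (piHom k (idComponentMap (glIncl ℂ ζ B)))) ∧
      (∀ (G : Type w) [Group G] [TopologicalSpace G] [IsTopologicalGroup G]
      (X : Type u) [MetricSpace X] [CompactSpace X]
      (P : Type v) [TopologicalSpace P] [MulAction G P] [ContinuousSMul G P]
      (ζ : PrincipalBundle G P X)
      (B : Type z) [NonUnitalNormedRing B] [NormedSpace ℂ B] [IsScalarTower ℂ B B]
      [SMulCommClass ℂ B B] [CompleteSpace B]
      [DistribMulAction G B] [ContinuousSMul G B] [MulAct G B] [SMulCommClass G ℂ B]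
      (X' : Type u) [MetricSpace X'] [CompactSpace X']
      (P' : Type v) [TopologicalSpace P'] [MulAction G P'] [ContinuousSMul G P']
      (ζ' : PrincipalBundle G P' X')
      (B' : Type z) [NonUnitalNormedRing B'] [NormedSpace ℂ B'] [IsScalarTower ℂ B' B']
      [SMulCommClass ℂ B' B'] [CompleteSpace B']
      [DistribMulAction G B'] [ContinuousSMul G B'] [MulAct G B'] [SMulCommClass G ℂ B']
      (m : BundleMap ζ' ζ) (α : EquivariantHom ℂ G B B'),
        (piHom k (idComponentMap (glIncl ℂ ζ' B'))).comp (piHom k (idComponentMap (glMap m α))) =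
          (piHom k (idComponentMap (glPlusMap m α))).comp
            (piHom k (idComponentMap (glIncl ℂ ζ B))))) ∧
    -- real case, `j = k + 1 ≥ 1`: natural isomorphisms of homotopy groups
    (∀ (k : ℕ), 1 ≤ k + 1 →
      (∀ (G : Type w) [Group G] [TopologicalSpace G] [IsTopologicalGroup G]
      (X : Type u) [MetricSpace X] [CompactSpace X]
      (P : Type v) [TopologicalSpace P] [MulAction G P] [ContinuousSMul G P]
      (ζ : PrincipalBundle G P X)
      (B : Type z) [NonUnitalNormedRing B] [NormedSpace ℝ B] [IsScalarTower ℝ B B]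
      [SMulCommClass ℝ B B] [CompleteSpace B]
      [DistribMulAction G B] [ContinuousSMul G B] [MulAct G B] [SMulCommClass G ℝ B],
        Function.Bijective (piHom k (idComponentMap (glIncl ℝ ζ B)))) ∧
      (∀ (G : Type w) [Group G] [TopologicalSpace G] [IsTopologicalGroup G]
      (X : Type u) [MetricSpace X] [CompactSpace X]
      (P : Type v) [TopologicalSpace P] [MulAction G P] [ContinuousSMul G P]
      (ζ : PrincipalBundle G P X)
      (B : Type z) [NonUnitalNormedRing B] [NormedSpace ℝ B] [IsScalarTower ℝ B B]
      [SMulCommClass ℝ B B] [CompleteSpace B]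
      [DistribMulAction G B] [ContinuousSMul G B] [MulAct G B] [SMulCommClass G ℝ B]
      (X' : Type u) [MetricSpace X'] [CompactSpace X']
      (P' : Type v) [TopologicalSpace P'] [MulAction G P'] [ContinuousSMul G P']
      (ζ' : PrincipalBundle G P' X')
      (B' : Type z) [NonUnitalNormedRing B'] [NormedSpace ℝ B'] [IsScalarTower ℝ B' B']
      [SMulCommClass ℝ B' B'] [CompleteSpace B']
      [DistribMulAction G B'] [ContinuousSMul G B'] [MulAct G B'] [SMulCommClass G ℝ B']
      (m : BundleMap ζ' ζ) (α : EquivariantHom ℝ G B B'),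
        (piHom k (idComponentMap (glIncl ℝ ζ' B'))).comp (piHom k (idComponentMap (glMap m α))) =
          (piHom k (idComponentMap (glPlusMap m α))).comp
            (piHom k (idComponentMap (glIncl ℝ ζ B))))) := by
  -- Compact metric spaces are locally compact, normal and paracompact. The isomorphisms were built
  -- from the Čech side, so `θ₀` and `θ₁` are their inverses.
  refine ⟨⟨fun X _ _ => (cechOneEquiv X).symm, fun X _ _ => (cechZeroEquiv X).symm, ?_, ?_, ?_⟩,
    ?_, ?_⟩
  · intro X Y _ _ _ _ f
    exact ⟨cechOneEquiv_natural f, cechZeroEquiv_natural f⟩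
  · intro G _ _ _ X _ _ P _ _ _ ζ B _ _ _ _ _ _ _ _ _
    exact ⟨(isTopSplitting_gl ℂ ζ B).isSplitShortExact_pi0 _,
      (isTopSplitting_gl ℂ ζ B).isSplitShortExact_pi 0 _⟩
  · intro G _ _ _ X _ _ P _ _ _ ζ B _ _ _ _ _ _ _ _ _ X' _ _ P' _ _ _ ζ' B' _ _ _ _ _ _ _ _ _
      m α
    refine ⟨⟨?_, ?_, ?_⟩, ?_, ?_, ?_⟩
    · rw [pi0Hom_comp, pi0Hom_comp, glIncl_comp_glMap]
    · exact quot0_natural m α (cechOneEquiv_natural m.base)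
    · exact split0_natural m α (cechOneEquiv_natural m.base)
    · rw [piHom_comp, piHom_comp, glIncl_comp_glMap]
    · exact quot1_natural m α (cechZeroEquiv_natural m.base)
    · exact split1_natural m α (cechZeroEquiv_natural m.base)
  · intro k hk
    refine ⟨?_, ?_⟩
    · intro G _ _ _ X _ _ P _ _ _ ζ B _ _ _ _ _ _ _ _ _
      -- The complementary factor is the identity component of `C(X, ℂˣ)`, whose homotopy vanishes
      -- in these degrees.
      exact (isTopSplitting_gl ℂ ζ B).idComponent.piHom_bijective k
        (homotopic_const_idComponent (homotopic_const_complex hk))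
    · intro G _ _ _ X _ _ P _ _ _ ζ B _ _ _ _ _ _ _ _ _ X' _ _ P' _ _ _ ζ' B' _ _ _ _ _ _ _ _ _
        m α
      exact piHom_idComponentMap_glIncl_natural k m α
  · intro k _
    refine ⟨?_, ?_⟩
    · intro G _ _ _ X _ _ P _ _ _ ζ B _ _ _ _ _ _ _ _ _
      exact (isTopSplitting_gl ℝ ζ B).idComponent.piHom_bijective k
        (homotopic_const_idComponent homotopic_const_real)
    · intro G _ _ _ X _ _ P _ _ _ ζ B _ _ _ _ _ _ _ _ _ X' _ _ P' _ _ _ ζ' B' _ _ _ _ _ _ _ _ _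
        m α
      exact piHom_idComponentMap_glIncl_natural k m α
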